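/- All Banach spaces are real. For a separable Banach space $X$, $\varepsilon\ge 0$ and $K\subset X^*$ let $\iota_\varepsilon K$ be $K$ with every weak$^*$-open set $V$ such that $\operatorname{diam}(V\cap K)\le\varepsilon$ removed, and let $\hat\iota_\varepsilon K=\overline{\mathrm{co}}^{\,w^*}\iota_\varepsilon K$. These derivations are iterated transfinitely, taking intersections at limit ordinals. $\mathrm{Sz}(X,\varepsilon)$ is the least countable ordinal $\alpha$ with $\iota_\varepsilon^\alpha B_{X^*}=\emptyset$ ($\omega_1$ if there is none), $\mathrm{Sz}(X)=\sup_{\varepsilon>0}\mathrm{Sz}(X,\varepsilon)$, and $\mathrm{Cz}(X,\varepsilon)$ is defined like $\mathrm{Sz}(X,\varepsilon)$ with $\hat\iota_\varepsilon$ in place of $\iota_\varepsilon$, with value $\infty$ if that ordinal is infinite. Put $H(\tau)=(\mathrm{Cz}(X,\tau)-1)^{-1}$, with $1/\infty=0$. A full tree is a set $S$ of finite subsets of $\mathbb N$ containing $\emptyset$, closed under removing the largest element, and such that each $a\in S$ has infinitely many successors $a\cup\{n\}\in S$, $n>\max a$. A branch $\beta$ of $S$ is a sequence $\emptyset=a_0,a_1,a_2,\dots$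 in $S$ with $a_{k+1}$ a successor of $a_k$. A weakly null tree-map of height at most $h$ is a map $a\mapsto x_a\in X$ on a full tree $S$ with $x_\emptyset=0$, $x_a=0$ if $|a|>h$, and such that, for each $a\in S$, the sequence of the $x_b$, $b$ running through the successors of $a$ in $S$, is weakly null. $N(\sigma)\in\mathbb N\cup\{\infty\}$ is the least $N$ for which there is a weakly null tree-map of height at most $N+1$ with $\|x_a\|\le\sigma$ for all $a\in S$ and $\|\sum_{a\in\beta}x_a\|>1$ for every branch $\beta$. For $0\le\sigma,\tau\le1$, $\rho_X(\sigma)$ is the least constant with $\limsup\|x+x_n\|\le1+\rho_X(\sigma)$ whenever $\|x\|=1$, $x_n\to0$ weakly and $\limsup\|x_n\|\le\sigma$; $\theta_X(\tau)$ is the greatest constant with $\liminf\|x^*+x_n^*\|\ge1+\theta_X(\tau)$ whenever $\|x^*\|=1$, $x_n^*\to0$ weak$^*$ and $\liminf\|x_n^*\|\ge\tau$. With $d$ the Banach–Mazur distance, put $\varphi(\sigma)=\inf\{\rho_Y(\sigma):d(X,Y)\le2\}$ and $\psi(\tau)=\sup\{\theta_Y(\tau):d(X,Y)\le2\}$. Functions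 $f,g$ on $[0,1]$ are $C$-equivalent if $f(t)\ge g(t/C)$ and $g(t)\ge f(t/C)$ for all $0\le t\le1$. **Theorem.** There is an absolute constant $1\le C\le19200$ such that the following hold. (1) If $X$ is a separable Banach space with $\mathrm{Sz}(X)=\omega_0$, then for each $0<\tau<1$ there is a norm $|\cdot|$ on $X$ with $\frac12\|x\|\le|x|\le\|x\|$ for all $x\in X$ such that, writing $|\cdot|$ also for the dual norm, whenever $x^*,x_n^*\in X^*$ satisfy $|x^*|=1$, $|x_n^*|=\tau$ for all $n$ and $x_n^*\to0$ weak$^*$, $$\liminf_{n\to\infty}|x^*+x_n^*|\ \ge\ 1+\frac1{\mathrm{Cz}(X,\tau/C)}.$$ (2) If $X$ is a separable infinite-dimensional Banach space containing no subspace isomorphic to $\ell_1$, then $\sigma\mapsto N(\sigma)^{-1}$ is $C$-equivalent to $\varphi$, and $H$ is $C$-equivalent to $\psi$. -/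

import Mathlib

open Filter Topology
open scoped ENNReal

universe u

noncomputable section

namespace Szlenk

/-! ### The Szlenk derivations and the indices `Sz` and `Cz` -/

section Index

variable (X : Type u) [NormedAddCommGroup X] [NormedSpace ℝ X]

/-- The closed unit ball of the dual, as a subset of the dual with its weak* topology. -/
def dualBall : Set (WeakDual ℝ X) :=
  {f | ‖WeakDual.toStrongDual f‖ ≤ 1}

variable {X}

/-- The `ε`-interior `ι_ε K`: what is left of `K` after removing every weak*-open set `V`
such that `V ∩ K` has norm diameter at most `ε`. -/
def iota (ε : ℝ) (K : Set (WeakDual ℝ X)) : Set (WeakDual ℝ X) :=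
  K \ ⋃₀ {V | IsOpen V ∧
    Metric.ediam ((WeakDual.toStrongDual : WeakDual ℝ X → StrongDual ℝ X) '' (V ∩ K)) ≤
      ENNReal.ofReal ε}

/-- The convex derivation: the weak*-closed convex hull of `ι_ε K`. -/
def iotaHat (ε : ℝ) (K : Set (WeakDual ℝ X)) : Set (WeakDual ℝ X) :=
  closure (convexHull ℝ (iota ε K))

/-- Transfinite iteration of a set derivation `D`, with intersections at limit ordinals. -/
def iter (D : Set (WeakDual ℝ X) → Set (WeakDual ℝ X)) (K : Set (WeakDual ℝ X))
    (α : Ordinal.{0}) : Set (WeakDual ℝ X) :=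
  Ordinal.limitRecOn α K (fun _ S => D S) (fun α _ S => ⋂ (β) (h : β < α), S β h)

variable (X)

/-- The least countable ordinal `α` such that the `α`-th derivative of the dual ball is empty,
and `ω₁` if there is no such ordinal. -/
def index (D : Set (WeakDual ℝ X) → Set (WeakDual ℝ X)) : Ordinal.{0} :=
  sInf (insert (Ordinal.omega 1)
    {α | α < Ordinal.omega 1 ∧ iter D (dualBall X) α = ∅})

/-- `Sz(X, ε)` as an ordinal. -/
def SzAt (ε : ℝ) : Ordinal.{0} := index X (iota ε)

/-- The Szlenk index `Sz(X) = sup_{ε > 0} Sz(X, ε)`. -/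
def Sz : Ordinal.{0} := ⨆ ε : Set.Ioi (0 : ℝ), SzAt X ε

/-- The convex index `Cz(X, ε)` as an ordinal. -/
def CzOrd (ε : ℝ) : Ordinal.{0} := index X (iotaHat ε)

/-- `Cz(X, ε)` with the convention that it is `∞` unless it is a finite ordinal. -/
def Cz (ε : ℝ) : ℕ∞ := ⨅ (n : ℕ) (_ : CzOrd X ε = n), (n : ℕ∞)

/-- `H(τ) = (Cz(X, τ) - 1)⁻¹`, which is `0` when `Cz(X, τ) = ∞`. -/
def H (τ : ℝ) : ℝ≥0∞ := ((Cz X τ : ℝ≥0∞) - 1)⁻¹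

end Index

/-! ### Trees, tree-maps and `N(σ)` -/

/-- `b` is a successor of `a`: it is obtained by adding one element above all those of `a`. -/
def IsSucc (a b : Finset ℕ) : Prop := ∃ n, (∀ m ∈ a, m < n) ∧ b = insert n a

/-- Full trees of finite subsets of `ℕ` (ordered by "is an initial segment of"). -/
structure IsFullTree (S : Set (Finset ℕ)) : Prop where
  empty_mem : ∅ ∈ S
  infinite_succ : ∀ a ∈ S, {b | b ∈ S ∧ IsSucc a b}.Infinite
  pred_mem : ∀ a b, IsSucc a b → b ∈ S → a ∈ S

/-- Branches of a tree. -/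
structure IsBranch (S : Set (Finset ℕ)) (β : ℕ → Finset ℕ) : Prop where
  zero : β 0 = ∅
  mem : ∀ k, β k ∈ S
  succ : ∀ k, IsSucc (β k) (β (k + 1))

section Tree

variable {X : Type u} [NormedAddCommGroup X] [NormedSpace ℝ X]

/-- `x` (restricted to `S`) is a weakly null tree-map of finite height at most `h`.
The successors of `a` are enumerated by their new largest element `n`. -/
structure IsWeaklyNullTreeMap (S : Set (Finset ℕ)) (x : Finset ℕ → X) (h : ℕ) : Prop where
  fullTree : IsFullTree S
  map_empty : x ∅ = 0
  height : ∀ a ∈ S, h < a.card → x a = 0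
  weaklyNull : ∀ a ∈ S, ∀ f : StrongDual ℝ X,
    Tendsto (fun n => f (x (insert n a)))
      (atTop ⊓ 𝓟 {n | (∀ m ∈ a, m < n) ∧ insert n a ∈ S}) (𝓝 0)

variable (X)

/-- `N(σ)`: the least `N` for which there is a weakly null tree-map of height `N + 1`, bounded
by `σ`, whose sum along each branch has norm `> 1` (and `∞` if there is none).  Asking for
height at most `N + 1` gives the same least `N`. -/
def N (σ : ℝ) : ℕ∞ :=
  ⨅ (n : ℕ) (_ : ∃ (S : Set (Finset ℕ)) (x : Finset ℕ → X),
      IsWeaklyNullTreeMap S x (n + 1) ∧ (∀ a ∈ S, ‖x a‖ ≤ σ) ∧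
      ∀ β, IsBranch S β → 1 < ‖∑ k ∈ Finset.range (n + 2), x (β k)‖), (n : ℕ∞)

end Tree

/-! ### The moduli `ρ`, `θ`, `φ`, `ψ` -/

section Moduli

variable (X : Type u) [NormedAddCommGroup X] [NormedSpace ℝ X]

/-- `ρ_X(σ)`: the least constant `c` with `limsup ‖x + x_n‖ ≤ 1 + c` whenever `‖x‖ = 1`,
`x_n → 0` weakly and `limsup ‖x_n‖ ≤ σ`. -/
def rho (σ : ℝ) : ℝ≥0∞ :=
  sInf {c | ∀ (x : X) (xs : ℕ → X), ‖x‖ = 1 →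
    (∀ f : StrongDual ℝ X, Tendsto (fun n => f (xs n)) atTop (𝓝 0)) →
    limsup (fun n => ‖xs n‖ₑ) atTop ≤ ENNReal.ofReal σ →
    limsup (fun n => ‖x + xs n‖ₑ) atTop ≤ 1 + c}

/-- `θ_X(τ)`: the greatest constant `c` with `liminf ‖x* + x_n*‖ ≥ 1 + c` whenever `‖x*‖ = 1`,
`x_n* → 0` weak* and `liminf ‖x_n*‖ ≥ τ`. -/
def theta (τ : ℝ) : ℝ≥0∞ :=
  sSup {c | ∀ (f : StrongDual ℝ X) (fs : ℕ → StrongDual ℝ X), ‖f‖ = 1 →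
    Tendsto (fun n => StrongDual.toWeakDual (fs n)) atTop (𝓝 0) →
    ENNReal.ofReal τ ≤ liminf (fun n => ‖fs n‖ₑ) atTop →
    1 + c ≤ liminf (fun n => ‖f + fs n‖ₑ) atTop}

/-- The Banach–Mazur distance (`∞` for spaces that are not isomorphic). -/
def bmDist (Y : Type u) [NormedAddCommGroup Y] [NormedSpace ℝ Y] : ℝ≥0∞ :=
  ⨅ T : X ≃L[ℝ] Y, ‖(T : X →L[ℝ] Y)‖ₑ * ‖(T.symm : Y →L[ℝ] X)‖ₑ

/-- `φ(σ) = inf {ρ_Y(σ) : d(X, Y) ≤ 2}`, over Banach spaces `Y`. -/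
def phi (σ : ℝ) : ℝ≥0∞ :=
  sInf {r | ∃ (Y : Type u) (_ : NormedAddCommGroup Y) (_ : NormedSpace ℝ Y)
    (_ : CompleteSpace Y), bmDist X Y ≤ 2 ∧ r = rho Y σ}

/-- `ψ(τ) = sup {θ_Y(τ) : d(X, Y) ≤ 2}`, over Banach spaces `Y`. -/
def psi (τ : ℝ) : ℝ≥0∞ :=
  sSup {r | ∃ (Y : Type u) (_ : NormedAddCommGroup Y) (_ : NormedSpace ℝ Y)
    (_ : CompleteSpace Y), bmDist X Y ≤ 2 ∧ r = theta Y τ}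

/-- `X` has a subspace isomorphic to `ℓ₁`. -/
def ContainsEllOne : Prop :=
  ∃ T : lp (fun _ : ℕ => ℝ) 1 →L[ℝ] X, ∃ c : ℝ, 0 < c ∧ ∀ v, c * ‖v‖ ≤ ‖T v‖

variable {X}

/-- The dual norm of `f` for the (semi)norm `p` on `X`. -/
def dualNorm (p : Seminorm ℝ X) (f : StrongDual ℝ X) : ℝ≥0∞ :=
  ⨆ (x : X) (_ : p x ≤ 1), ‖f x‖ₑ

end Moduli

/-- `f` `C`-dominates `g` on `[0, 1]`. -/
def Dominates (C : ℝ) (f g : ℝ → ℝ≥0∞) : Prop :=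
  ∀ t : ℝ, 0 ≤ t → t ≤ 1 → g (t / C) ≤ f t

/-- `C`-equivalence of functions on `[0, 1]`. -/
def Equivalent (C : ℝ) (f g : ℝ → ℝ≥0∞) : Prop :=
  Dominates C f g ∧ Dominates C g f

end Szlenk

end

noncomputable section

namespace Szlenk

/-! The constant is `C = 100`. Part (2) consists of four dominations, and part (1) uses the same
renorming as the lower bound for `psi`.

Two dominations test an arbitrary `Y` isomorphic to `X` with constant 3. If `rho Y` is below `1/n`,
a branch can be followed so that the norm of the partial sum grows at each step by a factor at most
`1 + 1/n`; after `n + 1` steps the total factor is at most 6, too small for a tree-map with large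
sums (`inv_le_rho_of_treeMap`). If `c` is admissible for `theta Y`, each convex derivation shrinks
the set, measured in the dual of `Y`, by `c` times the initial radius, so a nonempty `n`-th
derivative forces `n * c ≤ 1` (`mul_le_one_of_der_nonempty`).

The other two construct a norm from a decreasing chain of convex symmetric sets: the winning
positions of a tree game in `X`, or the derivatives of the dual ball. Marking the `j`-th set with
the real number `j` and taking the convex hull in the product with `ℝ` gives each point a concave
height. In `X`, adding a weakly null sequence costs at most one level, which a dilation by `1 + 1/n`
towards the origin, of height `n`, recovers; the norm is the gauge of the points of height at least
`n/2` (`exists_smooth_norm`). In the dual, a weak* limit at distance `s` gains at least `s/ε - 1`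
levels (`gains_derHull`). Hence the convex function "norm of `f` plus `2 * (1 - height(f/2)/n)`"
drops by a multiple of `1/n` in such limits, and its sublevel set at 1 is the dual ball of the
required norm (`exists_kadec_norm`). -/

theorem iter_natCast {X : Type u} [NormedAddCommGroup X] [NormedSpace ℝ X]
    (D : Set (WeakDual ℝ X) → Set (WeakDual ℝ X)) (K : Set (WeakDual ℝ X)) (n : ℕ) :
    iter D K (n : Ordinal.{0}) = D^[n] K := by
  induction n with
  | zero => simp [iter]
  | succ n ih =>
    rw [Function.iterate_succ_apply', ← ih, Nat.cast_succ]
    simp only [iter]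
    rw [Ordinal.limitRecOn_add_one]

/-! ### Finite convex derivatives and the values of `Cz` and `H`. -/

section Cz

variable {X : Type u} [NormedAddCommGroup X] [NormedSpace ℝ X] {ε : ℝ}

/-- The finite iterates of the convex derivation of the dual ball. -/
def der (X : Type u) [NormedAddCommGroup X] [NormedSpace ℝ X] (ε : ℝ) (n : ℕ) :
    Set (WeakDual ℝ X) :=
  (iotaHat ε)^[n] (dualBall X)

theorem CzOrd_le_of_der_eq_empty {n : ℕ} (h : der X ε n = ∅) :
    CzOrd X ε ≤ (n : Ordinal.{0}) := by
  refine csInf_le' (Or.inr ⟨?_, ?_⟩)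
  · exact lt_of_lt_of_le (Ordinal.natCast_lt_omega0 n) (Ordinal.omega0_le_omega 1)
  · rw [iter_natCast]; exact h

theorem der_eq_empty_of_CzOrd_eq {n : ℕ} (h : CzOrd X ε = (n : Ordinal.{0})) :
    der X ε n = ∅ := by
  have hm : CzOrd X ε ∈ insert (Ordinal.omega 1)
      {α | α < Ordinal.omega 1 ∧ iter (iotaHat ε) (dualBall X) α = ∅} :=
    csInf_mem ⟨_, Set.mem_insert _ _⟩
  rw [h] at hm
  rcases hm with hm | hm
  · exact absurd hm (lt_of_lt_of_le (Ordinal.natCast_lt_omega0 n) (Ordinal.omega0_le_omega 1)).ne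
  · rw [← hm.2, iter_natCast]; rfl

theorem Cz_eq_natCast {n : ℕ} (h : CzOrd X ε = (n : Ordinal.{0})) : Cz X ε = n := by
  refine le_antisymm (iInf₂_le n h) (le_iInf₂ fun m hm => ?_)
  have : m = n := by exact_mod_cast hm.symm.trans h
  rw [this]

theorem Cz_le_of_der_eq_empty {n : ℕ} (h : der X ε n = ∅) : Cz X ε ≤ n := by
  have h1 := CzOrd_le_of_der_eq_empty h
  obtain ⟨m, hm⟩ := Ordinal.lt_omega0.1 (h1.trans_lt (Ordinal.natCast_lt_omega0 n))
  rw [Cz_eq_natCast hm]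
  rw [hm] at h1
  exact_mod_cast h1

theorem der_nonempty_of_lt_Cz {n : ℕ} (h : (n : ℕ∞) < Cz X ε) : (der X ε n).Nonempty := by
  by_contra hn
  exact absurd h (Cz_le_of_der_eq_empty (Set.not_nonempty_iff_eq_empty.1 hn)).not_gt

theorem zero_mem_dualBall : (0 : WeakDual ℝ X) ∈ dualBall X := by
  simp [dualBall]

/-- `Cz` is either infinite or of the form `n + 1` with the `n + 1`-st derivative empty. -/
theorem Cz_eq_top_or : Cz X ε = ⊤ ∨
    ∃ n : ℕ, Cz X ε = (n + 1 : ℕ) ∧ (der X ε n).Nonempty ∧ der X ε (n + 1) = ∅ := by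
  by_cases h : ∃ m : ℕ, CzOrd X ε = (m : Ordinal.{0})
  · obtain ⟨m, hm⟩ := h
    have h0 := der_eq_empty_of_CzOrd_eq hm
    have h1 := Cz_eq_natCast hm
    right
    rcases m with _ | n
    · exact absurd h0 (Set.Nonempty.ne_empty ⟨0, zero_mem_dualBall⟩)
    · refine ⟨n, h1, der_nonempty_of_lt_Cz ?_, h0⟩
      rw [h1]; exact_mod_cast Nat.lt_succ_self n
  · left
    refine iInf₂_eq_top.2 fun n hn => absurd ⟨n, hn⟩ h

theorem H_eq_inv {n : ℕ} (h : Cz X ε = (n + 1 : ℕ)) : H X ε = ((n : ℝ≥0∞))⁻¹ := by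
  simp [H, h]

theorem H_eq_zero (h : Cz X ε = ⊤) : H X ε = 0 := by
  simp [H, h]

end Cz

/-! ### Equivalent norms and Banach–Mazur distance. -/

section Renorming

variable {X : Type u} [NormedAddCommGroup X] [NormedSpace ℝ X]

/-- A copy of `X`, to carry another norm. -/
def Renormed (X : Type u) : Type u := X

instance : AddCommGroup (Renormed X) := inferInstanceAs (AddCommGroup X)

instance : Module ℝ (Renormed X) := inferInstanceAs (Module ℝ X)

/-- The identity map onto the copy. -/
def toRenormed (X : Type u) [NormedAddCommGroup X] [NormedSpace ℝ X] : X ≃ₗ[ℝ] Renormed X :=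
  LinearEquiv.refl ℝ X

theorem exists_renorming [CompleteSpace X] (p : Seminorm ℝ X) {a b : ℝ} (ha : 0 < a)
    (hab : b ≤ 2 * a) (hp : ∀ x, a * ‖x‖ ≤ p x ∧ p x ≤ b * ‖x‖) :
    ∃ (Y : Type u) (_ : NormedAddCommGroup Y) (_ : NormedSpace ℝ Y) (_ : CompleteSpace Y)
      (T : X ≃L[ℝ] Y), (∀ x, ‖T x‖ = p x) ∧ bmDist X Y ≤ 2 := by
  let q : AddGroupNorm (Renormed X) :=
    { toFun := fun x => p ((toRenormed X).symm x)
      map_zero' := by simp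
      add_le' := fun x y => by rw [map_add]; exact map_add_le_add p _ _
      neg' := fun x => by rw [map_neg]; exact map_neg_eq_map p _
      eq_zero_of_map_eq_zero' := fun x hx => by
        have h1 := (hp ((toRenormed X).symm x)).1
        rw [hx] at h1
        have h2 : ‖(toRenormed X).symm x‖ ≤ 0 := by nlinarith
        simpa using h2 }
  let iN : NormedAddCommGroup (Renormed X) := q.toNormedAddCommGroup
  have hn : ∀ x : Renormed X, ‖x‖ = p ((toRenormed X).symm x) := fun _ => rfl
  let iS : NormedSpace ℝ (Renormed X) :=
    { norm_smul_le := fun c x => by rw [hn, hn, map_smul, map_smul_eq_mul] }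
  have h1 : ∀ x, ‖toRenormed X x‖ ≤ b * ‖x‖ := fun x => by rw [hn]; simpa using (hp x).2
  have h2 : ∀ y, ‖(toRenormed X).symm y‖ ≤ a⁻¹ * ‖y‖ := fun y => by
    rw [hn, ← div_eq_inv_mul, le_div_iff₀ ha, mul_comm]; exact (hp _).1
  let T : X ≃L[ℝ] Renormed X := (toRenormed X).toContinuousLinearEquivOfBounds b a⁻¹ h1 h2
  have hT : ∀ x, ‖T x‖ = p x := fun x => hn _
  refine ⟨Renormed X, iN, iS, (completeSpace_congr (e := T.toEquiv) T.isUniformEmbedding).1 inferInstance, T,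
    hT, ?_⟩
  refine (iInf_le _ T).trans ?_
  have e1 : ‖(T : X →L[ℝ] Renormed X)‖ₑ ≤ ENNReal.ofReal (2 * a) := by
    rw [← ofReal_norm]
    refine ENNReal.ofReal_le_ofReal (ContinuousLinearMap.opNorm_le_bound _ (by positivity) ?_)
    intro x
    exact (h1 x).trans (by gcongr)
  have e2 : ‖(T.symm : Renormed X →L[ℝ] X)‖ₑ ≤ ENNReal.ofReal a⁻¹ := by
    rw [← ofReal_norm]
    exact ENNReal.ofReal_le_ofReal (ContinuousLinearMap.opNorm_le_bound _ (by positivity) h2)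
  refine (mul_le_mul' e1 e2).trans ?_
  rw [← ENNReal.ofReal_mul (by positivity)]
  have : 2 * a * a⁻¹ = 2 := by field_simp
  rw [this]
  simp

/-- Spaces at Banach–Mazur distance at most `2` are isomorphic with constant `3`. -/
theorem exists_equiv_of_bmDist_le {Y : Type u} [NormedAddCommGroup Y] [NormedSpace ℝ Y]
    (h : bmDist X Y ≤ 2) : ∃ T : X ≃L[ℝ] Y,
      ‖(T : X →L[ℝ] Y)‖ * ‖(T.symm : Y →L[ℝ] X)‖ ≤ 3 := by
  have h3 : bmDist X Y < 3 := h.trans_lt (by norm_num)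
  obtain ⟨T, hT⟩ := iInf_lt_iff.1 h3
  refine ⟨T, ?_⟩
  rw [← ofReal_norm, ← ofReal_norm, ← ENNReal.ofReal_mul (norm_nonneg _)] at hT
  have : (3 : ℝ≥0∞) = ENNReal.ofReal 3 := by simp
  rw [this] at hT
  exact ((ENNReal.ofReal_lt_ofReal_iff (by norm_num)).1 hT).le

end Renorming

end Szlenk

namespace Szlenk

/-! ### The tree game and its relation to `N`. -/

section Game

variable {X : Type u} [NormedAddCommGroup X] [NormedSpace ℝ X]

/-- Weakly null sequences. -/
def WeaklyNull (xs : ℕ → X) : Prop :=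
  ∀ f : StrongDual ℝ X, Tendsto (fun n => f (xs n)) atTop (𝓝 0)

theorem WeaklyNull.smul {xs : ℕ → X} (h : WeaklyNull xs) (c : ℝ) :
    WeaklyNull (fun n => c • xs n) := fun f => by
  simpa using (h f).const_mul c

theorem WeaklyNull.neg {xs : ℕ → X} (h : WeaklyNull xs) : WeaklyNull (fun n => -xs n) :=
  fun f => by simpa using (h f).neg

theorem WeaklyNull.comp {xs : ℕ → X} (h : WeaklyNull xs) {φ : ℕ → ℕ}
    (hφ : Tendsto φ atTop atTop) : WeaklyNull (xs ∘ φ) := fun f => (h f).comp hφ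

theorem weaklyNull_zero : WeaklyNull (fun _ : ℕ => (0 : X)) := fun f => by simp

/-- The positions from which the player choosing branches wins the tree game with `j` moves left,
the other player choosing weakly null sequences bounded by `σ`. -/
def gameSet (X : Type u) [NormedAddCommGroup X] [NormedSpace ℝ X] (σ : ℝ) : ℕ → Set X
  | 0 => {x | ‖x‖ ≤ 1}
  | j + 1 => {x | ∀ xs : ℕ → X, WeaklyNull xs → (∀ n, ‖xs n‖ ≤ σ) →
      ∀ᶠ n in atTop, x + xs n ∈ gameSet X σ j}

variable {σ : ℝ}

theorem gameSet_succ_subset (hσ : 0 ≤ σ) (j : ℕ) : gameSet X σ (j + 1) ⊆ gameSet X σ j := by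
  intro x hx
  obtain ⟨n, hn⟩ := (hx (fun _ => 0) weaklyNull_zero (by simpa using hσ)).exists
  simpa using hn

theorem gameSet_antitone (hσ : 0 ≤ σ) : Antitone (gameSet X σ) :=
  antitone_nat_of_succ_le (gameSet_succ_subset hσ)

/-- One and the same sequence is added to both positions, so convex combinations of winning
positions stay winning. -/
theorem convex_gameSet (j : ℕ) : Convex ℝ (gameSet X σ j) := by
  induction j with
  | zero =>
    have : gameSet X σ 0 = Metric.closedBall (0 : X) 1 := by ext; simp [gameSet]
    rw [this]; exact convex_closedBall _ _
  | succ j ih =>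
    intro x hx y hy a b ha hb hab xs h1 h2
    filter_upwards [hx xs h1 h2, hy xs h1 h2] with n hxn hyn
    have := ih hxn hyn ha hb hab
    rwa [smul_add, smul_add, add_add_add_comm, ← add_smul, hab, one_smul] at this

theorem neg_mem_gameSet {j : ℕ} : ∀ {x : X}, x ∈ gameSet X σ j → -x ∈ gameSet X σ j := by
  induction j with
  | zero => intro x hx; simpa [gameSet] using hx
  | succ j ih =>
    intro x hx xs h1 h2
    filter_upwards [hx (fun n => -xs n) h1.neg (by simpa using h2)] with n hn
    have := ih hn
    rwa [neg_add, neg_neg] at this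

/-- A sequence refuting a position is bad only frequently; a subsequence is bad at every term. This
lets the strategy be played on the tree of all finite sets. -/
theorem exists_winning_sequences (hσ : 0 ≤ σ) : ∃ z : X → ℕ → ℕ → X,
    (∀ s j, WeaklyNull (z s j)) ∧ (∀ s j n, ‖z s j n‖ ≤ σ) ∧
    ∀ s j, s ∉ gameSet X σ (j + 1) → ∀ n, s + z s j n ∉ gameSet X σ j := by
  have key : ∀ (s : X) (j : ℕ), ∃ z : ℕ → X, WeaklyNull z ∧ (∀ n, ‖z n‖ ≤ σ) ∧
      (s ∉ gameSet X σ (j + 1) → ∀ n, s + z n ∉ gameSet X σ j) := by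
    intro s j
    by_cases h : s ∈ gameSet X σ (j + 1)
    · exact ⟨fun _ => 0, weaklyNull_zero, by simpa using hσ, fun h' => absurd h h'⟩
    · have h' := h
      simp only [gameSet, Set.mem_ofPred_eq, not_forall, not_eventually] at h'
      obtain ⟨xs, h1, h2, h3⟩ := h'
      obtain ⟨φ, hφ, hφ'⟩ := extraction_of_frequently_atTop h3
      exact ⟨xs ∘ φ, h1.comp hφ.tendsto_atTop, fun n => h2 _, fun _ n => hφ' n⟩
  choose z h1 h2 h3 using key
  exact ⟨z, h1, h2, h3⟩

/-- The position reached after `k` moves along the node `a` when the sequences are chosen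
by `z` in a game of length `n`. -/
def position (z : X → ℕ → ℕ → X) (n : ℕ) : ℕ → Finset ℕ → X
  | 0, _ => 0
  | k + 1, a => position z n k (a.erase (a.sup id)) +
      z (position z n k (a.erase (a.sup id))) (n - 1 - k) (a.sup id)

/-- The tree-map of the moves chosen by `z` in a game of length `n`. -/
def strategyMap (z : X → ℕ → ℕ → X) (n : ℕ) (a : Finset ℕ) : X :=
  if a.card = 0 ∨ n < a.card then 0
  else z (position z n (a.card - 1) (a.erase (a.sup id))) (n - a.card) (a.sup id)

theorem sup_insert_of_forall_lt {a : Finset ℕ} {m : ℕ} (h : ∀ i ∈ a, i < m) :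
    (insert m a).sup id = m := by
  rw [Finset.sup_insert, id]
  exact sup_eq_left.2 (Finset.sup_le fun i hi => (h i hi).le)

theorem card_insert_of_forall_lt {a : Finset ℕ} {m : ℕ} (h : ∀ i ∈ a, i < m) :
    (insert m a).card = a.card + 1 :=
  Finset.card_insert_of_notMem fun hm => lt_irrefl _ (h m hm)

theorem erase_insert_of_forall_lt {a : Finset ℕ} {m : ℕ} (h : ∀ i ∈ a, i < m) :
    (insert m a).erase m = a :=
  Finset.erase_insert fun hm => lt_irrefl _ (h m hm)

theorem position_insert {Y : Type u} [NormedAddCommGroup Y] (z : Y → ℕ → ℕ → Y) (n k : ℕ) {a : Finset ℕ} {m : ℕ}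
    (h : ∀ i ∈ a, i < m) :
    position z n (k + 1) (insert m a) = position z n k a + z (position z n k a) (n - 1 - k) m := by
  rw [position, sup_insert_of_forall_lt h, erase_insert_of_forall_lt h]

theorem strategyMap_insert {Y : Type u} [NormedAddCommGroup Y] (z : Y → ℕ → ℕ → Y) {n : ℕ} {a : Finset ℕ} {m : ℕ}
    (h : ∀ i ∈ a, i < m) (hn : a.card < n) :
    strategyMap z n (insert m a) = z (position z n a.card a) (n - 1 - a.card) m := by
  rw [strategyMap, card_insert_of_forall_lt h, sup_insert_of_forall_lt h,
    erase_insert_of_forall_lt h, if_neg (by omega), Nat.add_sub_cancel]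
  congr 1
  omega

theorem IsBranch.card_eq {S : Set (Finset ℕ)} {β : ℕ → Finset ℕ} (h : IsBranch S β) (k : ℕ) :
    (β k).card = k := by
  induction k with
  | zero => simp [h.zero]
  | succ k ih =>
    obtain ⟨m, hm, he⟩ := h.succ k
    rw [he, card_insert_of_forall_lt hm, ih]

theorem isFullTree_univ : IsFullTree Set.univ where
  empty_mem := trivial
  pred_mem _ _ _ _ := trivial
  infinite_succ a _ := by
    refine Set.infinite_of_injective_forall_mem (f := fun i => insert (a.sup id + 1 + i) a) ?_ ?_
    · have h : ∀ i, ∀ j ∈ a, j < a.sup id + 1 + i := fun i j hj => by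
        have := Finset.le_sup (f := id) hj
        simp only [id] at this
        omega
      intro i j hij
      have := congrArg (fun b => b.sup id) hij
      simp only [sup_insert_of_forall_lt (h _)] at this
      omega
    · intro i
      refine ⟨trivial, _, fun j hj => ?_, rfl⟩
      have := Finset.le_sup (f := id) hj
      simp only [id] at this
      omega

/-- If the origin is not a winning position, then there is a tree-map with large sums. -/
theorem exists_treeMap_of_zero_notMem (hσ : 0 ≤ σ) {n : ℕ} (h : (0 : X) ∉ gameSet X σ n) :
    ∃ (S : Set (Finset ℕ)) (x : Finset ℕ → X),
      IsWeaklyNullTreeMap S x n ∧ (∀ a ∈ S, ‖x a‖ ≤ σ) ∧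
      ∀ β, IsBranch S β → 1 < ‖∑ k ∈ Finset.range (n + 1), x (β k)‖ := by
  obtain ⟨z, hz1, hz2, hz3⟩ := exists_winning_sequences (X := X) hσ
  refine ⟨Set.univ, strategyMap z n, ⟨isFullTree_univ, by simp [strategyMap], ?_, ?_⟩, ?_, ?_⟩
  · intro a _ ha
    simp [strategyMap, ha]
  · intro a _ f
    have hmem : {m | (∀ i ∈ a, i < m) ∧ insert m a ∈ (Set.univ : Set (Finset ℕ))} ∈
        atTop ⊓ 𝓟 {m | (∀ i ∈ a, i < m) ∧ insert m a ∈ (Set.univ : Set (Finset ℕ))} :=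
      mem_inf_of_right (mem_principal_self _)
    by_cases hn : a.card < n
    · refine Tendsto.congr' ?_ ((hz1 (position z n a.card a) (n - 1 - a.card) f).mono_left
        inf_le_left)
      filter_upwards [hmem] with m hm
      rw [strategyMap_insert z hm.1 hn]
    · refine Tendsto.congr' ?_ tendsto_const_nhds
      filter_upwards [hmem] with m hm
      rw [strategyMap, card_insert_of_forall_lt hm.1, if_pos (by omega), map_zero]
  · intro a _
    rw [strategyMap]
    split_ifs
    · simpa using hσ
    · exact hz2 _ _ _
  · intro β hβ
    have key : ∀ k ≤ n, position z n k (β k) = ∑ i ∈ Finset.range (k + 1), strategyMap z n (β i) ∧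
        position z n k (β k) ∉ gameSet X σ (n - k) := by
      intro k
      induction k with
      | zero => intro _; simpa [position, hβ.zero, strategyMap] using h
      | succ k ih =>
        intro hk
        obtain ⟨e1, e2⟩ := ih (by omega)
        obtain ⟨m, hm, he⟩ := hβ.succ k
        have hc := hβ.card_eq k
        rw [he, position_insert z n k hm, Finset.sum_range_succ, ← e1, he,
          strategyMap_insert z hm (by omega), hc]
        refine ⟨rfl, ?_⟩
        -- The second argument of `z` counts the moves left after the current one.
        have e3 : n - k = (n - 1 - k) + 1 := by omega
        rw [e3] at e2
        have e4 : n - (k + 1) = n - 1 - k := by omega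
        rw [e4]
        exact hz3 _ _ e2 _
    obtain ⟨e1, e2⟩ := key n le_rfl
    rw [e1, Nat.sub_self] at e2
    simpa [gameSet] using e2

theorem zero_mem_gameSet_of_le_N (hσ : 0 ≤ σ) {n : ℕ} (h : ((n + 1 : ℕ) : ℕ∞) ≤ N X σ) :
    (0 : X) ∈ gameSet X σ (n + 1) := by
  by_contra hn
  have h1 : N X σ ≤ n := iInf₂_le n (exists_treeMap_of_zero_notMem hσ hn)
  have := h.trans h1
  norm_cast at this
  omega

end Game

end Szlenk

namespace Szlenk

/-! ### Convex hulls of sets marked by a level. -/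

section Levels

variable {V : Type u}

/-- The points of the sets `A j`, `j ∈ s`, marked by their level `j`. -/
def levels (A : ℕ → Set V) (s : Set ℕ) : Set (V × ℝ) := {p | ∃ j ∈ s, p.1 ∈ A j ∧ p.2 = j}

theorem levels_mono (A : ℕ → Set V) {s t : Set ℕ} (h : s ⊆ t) : levels A s ⊆ levels A t :=
  fun _ ⟨j, hj, hp⟩ => ⟨j, h hj, hp⟩

theorem levels_union (A : ℕ → Set V) (s t : Set ℕ) :
    levels A (s ∪ t) = levels A s ∪ levels A t := by
  ext p
  constructor
  · rintro ⟨j, hj | hj, hp⟩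
    exacts [Or.inl ⟨j, hj, hp⟩, Or.inr ⟨j, hj, hp⟩]
  · rintro (⟨j, hj, hp⟩ | ⟨j, hj, hp⟩)
    exacts [⟨j, Or.inl hj, hp⟩, ⟨j, Or.inr hj, hp⟩]

theorem levels_singleton (A : ℕ → Set V) (j : ℕ) : levels A {j} = A j ×ˢ {(j : ℝ)} := by
  ext p; simp [levels]

variable [AddCommGroup V] [Module ℝ V]

theorem mem_hull_levels {A : ℕ → Set V} {s : Set ℕ} {j : ℕ} {x : V} (hj : j ∈ s) (hx : x ∈ A j) :
    (x, (j : ℝ)) ∈ convexHull ℝ (levels A s) :=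
  subset_convexHull ℝ _ ⟨j, hj, hx, rfl⟩

theorem hull_levels_subset {A : ℕ → Set V} {n : ℕ} {B : Set V} (hA : ∀ j, A j ⊆ B)
    (hB : Convex ℝ B) : convexHull ℝ (levels A (Set.Iic n)) ⊆ B ×ˢ Set.Icc 0 (n : ℝ) := by
  refine convexHull_min ?_ (hB.prod (convex_Icc _ _))
  rintro ⟨x, b⟩ ⟨j, hj, hx, hb⟩
  simp only at hb hx
  subst hb
  exact ⟨hA j hx, Nat.cast_nonneg j, Nat.cast_le.2 (Set.mem_Iic.1 hj)⟩

theorem neg_mem_hull_levels {A : ℕ → Set V} {s : Set ℕ} (hA : ∀ j, ∀ x ∈ A j, -x ∈ A j) {x : V}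
    {b : ℝ} (h : (x, b) ∈ convexHull ℝ (levels A s)) : (-x, b) ∈ convexHull ℝ (levels A s) := by
  let L : V × ℝ →ₗ[ℝ] V × ℝ := LinearMap.prodMap (-LinearMap.id) LinearMap.id
  have h1 : (levels A s) ⊆ L ⁻¹' (convexHull ℝ (levels A s)) := by
    rintro ⟨y, c⟩ ⟨j, hj, hy, hc⟩
    exact subset_convexHull ℝ _ ⟨j, hj, by simpa [L] using hA j y hy, by simpa [L] using hc⟩
  have := convexHull_min h1 ((convex_convexHull ℝ _).linear_preimage L) h
  simpa [L] using this

theorem combo_mem {W : Set (V × ℝ)} (hW : Convex ℝ W) {x y z : V} {b c d s : ℝ}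
    (hx : (x, b) ∈ W) (hy : (y, c) ∈ W) (h0 : 0 ≤ s) (h1 : s ≤ 1)
    (hz : z = (1 - s) • x + s • y) (hd : d = (1 - s) * b + s * c) : (z, d) ∈ W := by
  have := hW hx hy (sub_nonneg.2 h1) h0 (by ring)
  rw [hz, hd]
  simpa using this

end Levels

/-! ### An asymptotically smooth norm from the game: `phi` is dominated by `1/N`. -/

section Smooth

variable {X : Type u} [NormedAddCommGroup X] [NormedSpace ℝ X] {σ : ℝ}

/-- The convex hull of the marked winning positions. -/
def gameHull (X : Type u) [NormedAddCommGroup X] [NormedSpace ℝ X] (σ : ℝ) (n : ℕ) :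
    Set (X × ℝ) :=
  convexHull ℝ (levels (gameSet X σ) (Set.Iic n))

theorem convex_gameHull (n : ℕ) : Convex ℝ (gameHull X σ n) := convex_convexHull ℝ _

theorem gameHull_bounds (hσ : 0 ≤ σ) {n : ℕ} {x : X} {b : ℝ} (h : (x, b) ∈ gameHull X σ n) :
    ‖x‖ ≤ 1 ∧ 0 ≤ b ∧ b ≤ n := by
  have := hull_levels_subset (B := gameSet X σ 0) (fun j => gameSet_antitone hσ (Nat.zero_le j))
    (convex_gameSet 0) h
  exact ⟨this.1, this.2.1, this.2.2⟩

/-- By convexity only generators matter, and for them the definition of the game trades one move for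
one level. Level 0 is excluded because no move is left there. -/
theorem eventually_add_mem_of_pos_levels {n : ℕ} {xs : ℕ → X} (h0 : WeaklyNull xs)
    (h1 : ∀ m, ‖xs m‖ ≤ σ) {p : X × ℝ}
    (hp : p ∈ convexHull ℝ (levels (gameSet X σ) (Set.Icc 1 n))) :
    ∀ᶠ m in atTop, (p.1 + xs m, p.2 - 1) ∈ gameHull X σ n := by
  have hC : Convex ℝ {p : X × ℝ | ∀ᶠ m in atTop, (p.1 + xs m, p.2 - 1) ∈ gameHull X σ n} := by
    intro p hp q hq a b ha hb hab
    filter_upwards [hp, hq] with m h3 h4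
    have := convex_gameHull n h3 h4 ha hb hab
    convert this using 1
    ext
    · simp only [Prod.fst_add, Prod.smul_fst, smul_add]
      rw [add_add_add_comm, ← add_smul a b, hab, one_smul]
    · simp only [Prod.snd_add, Prod.smul_snd, smul_eq_mul]
      linear_combination hab
  refine convexHull_min ?_ hC hp
  rintro ⟨x, b⟩ ⟨j, hj, hx, hb⟩
  simp only at hx hb
  obtain ⟨i, rfl⟩ : ∃ i, j = i + 1 := ⟨j - 1, by have := hj.1; omega⟩
  have hin : i ≤ n := by have := hj.2; omega
  filter_upwards [hx xs h0 h1] with m hm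
  have := mem_hull_levels (s := Set.Iic n) hin hm
  subst hb
  simpa [gameHull] using this

/-- A point of height at least `n/2` is a convex combination of a point of level 0 and a point `q`
of positive levels. Only `q` is perturbed, by the sequence divided by its weight `t`, and the height
lost is `t ≤ 1`. -/
theorem eventually_add_mem_gameHull (hσ : 0 ≤ σ) {n : ℕ} (hn : 1 ≤ n)
    (hz : (0 : X) ∈ gameSet X σ n) {xs : ℕ → X}
    (h0 : WeaklyNull xs) (h1 : ∀ m, ‖xs m‖ ≤ σ / 2) {x : X} {b : ℝ} (hb : (n : ℝ) / 2 ≤ b)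
    (hx : (x, b) ∈ gameHull X σ n) :
    ∃ b', b - 1 ≤ b' ∧ ∀ᶠ m in atTop, (x + xs m, b') ∈ gameHull X σ n := by
  have hn0 : (0 : ℝ) < n := by exact_mod_cast hn
  have hsplit : Set.Iic n = {0} ∪ Set.Icc 1 n := by
    ext j; simp only [Set.mem_Iic, Set.mem_union, Set.mem_singleton_iff, Set.mem_Icc]; omega
  have hx' := hx
  rw [gameHull, hsplit, levels_union, convexHull_union] at hx'
  · rw [mem_convexJoin] at hx'
    obtain ⟨p, hp, q, hq, s, t, hs, ht, hst, he⟩ := hx'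
    rw [levels_singleton, ((convex_gameSet 0).prod (convex_singleton _)).convexHull_eq] at hp
    have hp2 : p.2 = 0 := by simpa using hp.2
    have hqG : q ∈ gameHull X σ n := convexHull_mono (levels_mono _ fun j hj => hj.2) hq
    obtain ⟨-, hq0, hqn⟩ := gameHull_bounds hσ (x := q.1) (b := q.2) hqG
    have e1 : s • p.1 + t • q.1 = x := by simpa using congrArg Prod.fst he
    have e2 : t * q.2 = b := by simpa [hp2] using congrArg Prod.snd he
    -- From `t * q.2 = b ≥ n/2` and `q.2 ≤ n`; this is why the sequence is bounded by `σ / 2`.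
    have ht2 : 1 / 2 ≤ t := by nlinarith
    have ht0 : 0 < t := by linarith
    have hpG : (p.1, (0 : ℝ)) ∈ gameHull X σ n := by
      simpa [gameHull] using mem_hull_levels (s := Set.Iic n) (Nat.zero_le n) hp.1
    refine ⟨t * (q.2 - 1), by nlinarith, ?_⟩
    filter_upwards [eventually_add_mem_of_pos_levels (h0.smul t⁻¹) (fun m => by
      rw [norm_smul, Real.norm_of_nonneg (by positivity)]
      calc t⁻¹ * ‖xs m‖ ≤ 2 * (σ / 2) := by
            refine mul_le_mul ?_ (h1 m) (norm_nonneg _) (by norm_num)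
            rw [inv_le_comm₀ ht0 (by norm_num)]; linarith
        _ = σ := by ring) hq] with m hm
    refine combo_mem (convex_gameHull n) hpG hm ht0.le (by linarith) ?_ (by ring)
    rw [smul_add, smul_inv_smul₀ ht0.ne', ← add_assoc, ← e1, ← hst, add_sub_cancel_right]
  · exact ⟨(0, 0), 0, rfl, by simp [gameSet], by simp⟩
  · exact ⟨(0, n), n, ⟨hn, le_rfl⟩, hz, rfl⟩

/-- If the origin is a winning position in the game of length `n`, there is an equivalent norm
which is smooth up to `1 / n` along weakly null sequences. -/
theorem exists_smooth_norm (hσ : 0 ≤ σ) {n : ℕ} (hn : 1 ≤ n) (hz : (0 : X) ∈ gameSet X σ n) :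
    ∃ p : Seminorm ℝ X, (∀ x, ‖x‖ ≤ p x ∧ p x ≤ 2 * ‖x‖) ∧
      ∀ (x : X) (xs : ℕ → X), p x < 1 → WeaklyNull xs → (∀ m, ‖xs m‖ ≤ σ / 4) →
        ∀ᶠ m in atTop, p (x + xs m) ≤ 1 + 1 / n := by
  have hn0 : (0 : ℝ) < n := by exact_mod_cast hn
  let D : Set X := {x | ∃ b : ℝ, (n : ℝ) / 2 ≤ b ∧ (x, b) ∈ gameHull X σ n}
  have htop : ((0 : X), (n : ℝ)) ∈ gameHull X σ n := mem_hull_levels (s := Set.Iic n) (Set.mem_Iic.2 le_rfl) hz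
  have hconv : Convex ℝ D := by
    rintro x ⟨b, hb, hx⟩ y ⟨c, hc, hy⟩ s t hs ht hst
    refine ⟨s * b + t * c, ?_, by simpa using convex_gameHull n hx hy hs ht hst⟩
    have : s * ((n : ℝ) / 2) + t * ((n : ℝ) / 2) = n / 2 := by rw [← add_mul, hst, one_mul]
    nlinarith [mul_le_mul_of_nonneg_left hb hs, mul_le_mul_of_nonneg_left hc ht]
  have hneg : ∀ ⦃x⦄, x ∈ D → -x ∈ D := fun x ⟨b, hb, hx⟩ =>
    ⟨b, hb, neg_mem_hull_levels (fun _ _ => neg_mem_gameSet) hx⟩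
  have hhalf : Metric.ball (0 : X) (1 / 2) ⊆ D := by
    intro x hx
    rw [mem_ball_zero_iff] at hx
    have h2 : (2 : ℝ) • x ∈ gameSet X σ 0 := by
      change ‖(2 : ℝ) • x‖ ≤ 1
      rw [norm_smul, Real.norm_of_nonneg (by norm_num)]; linarith
    refine ⟨n / 2, le_rfl, combo_mem (s := 1 / 2) (convex_gameHull n)
      (mem_hull_levels (s := Set.Iic n) (Nat.zero_le n) h2) htop (by norm_num) (by norm_num)
      ?_ ?_⟩
    · rw [smul_smul]; norm_num
    · push_cast; ring
  have hle : D ⊆ Metric.closedBall 0 1 := fun x ⟨b, hb, hx⟩ => by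
    simpa using (gameHull_bounds hσ hx).1
  have habs : Absorbent ℝ D := absorbent_nhds_zero
    (mem_of_superset (Metric.ball_mem_nhds _ (by norm_num)) hhalf)
  have h0D : (0 : X) ∈ D := hhalf (by simp)
  let p : Seminorm ℝ X := gaugeSeminorm ((balanced_iff_neg_mem hconv).2 hneg) hconv habs
  have hp : ∀ x, p x = gauge D x := fun _ => rfl
  refine ⟨p, fun x => ⟨?_, ?_⟩, ?_⟩
  · have := le_gauge_of_subset_closedBall (x := x) habs zero_le_one hle
    simpa [hp] using this
  · have := mul_gauge_le_norm (x := x) hhalf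
    rw [hp]; linarith
  · intro x xs hx h0 h1
    have hxD : x ∈ D := setOfPred_gauge_lt_one_subset_self hconv h0D habs hx
    obtain ⟨b, hb, hxb⟩ := hxD
    -- Moving by twice the sequence and averaging with the unmoved point halves the loss of height
    -- to `1/2`.
    obtain ⟨b', hb', hev⟩ := eventually_add_mem_gameHull hσ hn hz (h0.smul 2) (fun m => by
      rw [norm_smul, Real.norm_of_nonneg (by norm_num)]; linarith [h1 m]) hb hxb
    filter_upwards [hev] with m hm
    have h3 : (x + xs m, (1 - 1 / 2) * b + 1 / 2 * b') ∈ gameHull X σ n := by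
      refine combo_mem (s := 1 / 2) (convex_gameHull n) hxb hm (by norm_num) (by norm_num) ?_ rfl
      rw [smul_add, smul_smul, ← add_assoc, ← add_smul]
      norm_num
    have hl : (0 : ℝ) < 1 + 1 / n := by positivity
    have hl1 : (1 + 1 / (n : ℝ))⁻¹ ≤ 1 := inv_le_one_of_one_le₀ (by
      have : (0 : ℝ) < 1 / n := by positivity
      linarith)
    refine gauge_le_of_mem hl.le ((Set.mem_smul_set_iff_inv_smul_mem₀ hl.ne' _ _).2 ?_)
    refine ⟨_, ?_, combo_mem (convex_gameHull n) htop h3 (by positivity) hl1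
      (by rw [smul_zero, zero_add]) rfl⟩
    -- Shrinking towards the origin at height `n` with factor `λ = n/(n+1)` gives height at least `λ
    -- * (1 + n/2 - 1/2) = n/2`.
    have e : (1 - (1 + 1 / (n : ℝ))⁻¹) * n = (1 + 1 / (n : ℝ))⁻¹ := by field_simp; ring
    rw [e]
    have e3 : (n : ℝ) / 2 = (1 + 1 / (n : ℝ))⁻¹ * (1 + (n / 2 - 1 / 2)) := by field_simp; ring
    rw [e3, mul_add, mul_one]
    gcongr
    linarith

theorem limsup_enorm_le {Y : Type*} [NormedAddCommGroup Y] {u : ℕ → Y} {r : ℝ} (hr : 0 ≤ r)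
    (h : ∀ s, r < s → ∀ᶠ m in atTop, ‖u m‖ ≤ s) :
    limsup (fun m => ‖u m‖ₑ) atTop ≤ ENNReal.ofReal r := by
  refine le_of_forall_gt_imp_ge_of_dense fun y hy => ?_
  rcases eq_or_ne y ⊤ with rfl | hy'
  · exact le_top
  · have hs : r < y.toReal := (ENNReal.ofReal_lt_iff_lt_toReal hr hy').1 hy
    refine limsup_le_of_le (by isBoundedDefault) ?_
    filter_upwards [h _ hs] with m hm
    rw [← ofReal_norm]
    exact ENNReal.ofReal_le_of_le_toReal hm

theorem eventually_norm_lt_of_limsup {Y : Type*} [NormedAddCommGroup Y] {u : ℕ → Y} {r s : ℝ}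
    (h : limsup (fun m => ‖u m‖ₑ) atTop ≤ ENNReal.ofReal r) (hs : 0 < s) (hrs : r < s) :
    ∀ᶠ m in atTop, ‖u m‖ < s := by
  have h1 : limsup (fun m => ‖u m‖ₑ) atTop < ENNReal.ofReal s :=
    h.trans_lt ((ENNReal.ofReal_lt_ofReal_iff hs).2 hrs)
  filter_upwards [eventually_lt_of_limsup_lt h1] with m hm
  rw [← ofReal_norm] at hm
  exact (ENNReal.ofReal_lt_ofReal_iff hs).1 hm

theorem phi_le_rho {Y : Type u} [NormedAddCommGroup Y] [NormedSpace ℝ Y] [CompleteSpace Y]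
    (h : bmDist X Y ≤ 2) (σ : ℝ) : phi X σ ≤ rho Y σ :=
  sInf_le ⟨Y, inferInstance, inferInstance, inferInstance, h, rfl⟩

theorem phi_le_inv_of_zero_mem_gameSet [CompleteSpace X] (hσ : 0 < σ) {n : ℕ} (hn : 1 ≤ n)
    (hz : (0 : X) ∈ gameSet X σ n) : phi X (σ / 100) ≤ ((n : ℝ≥0∞))⁻¹ := by
  have hn0 : (0 : ℝ) < n := by exact_mod_cast hn
  obtain ⟨p, hp, hps⟩ := exists_smooth_norm hσ.le hn hz
  obtain ⟨Y, _, _, _, T, hT, hd⟩ := exists_renorming p one_pos (b := 2) (by norm_num)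
    (fun x => by simpa using hp x)
  refine (phi_le_rho hd _).trans (sInf_le ?_)
  intro y ys hy hw hl
  have e : 1 + ((n : ℝ≥0∞))⁻¹ = ENNReal.ofReal (1 + 1 / n) := by
    rw [ENNReal.ofReal_add zero_le_one (by positivity), one_div, ENNReal.ofReal_inv_of_pos hn0]
    simp
  rw [e]
  refine limsup_enorm_le (by positivity) fun s hs => ?_
  have hr : (0 : ℝ) < 1 + 1 / n := by positivity
  -- Dividing by `c > 1` moves a unit vector strictly inside the ball, as `exists_smooth_norm`
  -- requires.
  set c : ℝ := s / (1 + 1 / n) with hc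
  have hc1 : 1 < c := (one_lt_div hr).2 hs
  have hc0 : 0 < c := by linarith
  -- Only the `limsup` is bounded, so the finitely many terms that are too large are replaced by 0.
  let xs : ℕ → X := fun m => if ‖T.symm (ys m)‖ ≤ σ / 4 then T.symm (ys m) else 0
  have hpy : ∀ y, p (T.symm y) = ‖y‖ := fun y => by rw [← hT, T.apply_symm_apply]
  have hev : ∀ᶠ m in atTop, xs m = T.symm (ys m) := by
    filter_upwards [eventually_norm_lt_of_limsup hl (s := σ / 4) (by positivity) (by linarith)]
      with m hm
    refine if_pos (((hp _).1.trans ?_).trans hm.le)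
    rw [hpy]
  have hxs : WeaklyNull xs := fun f => by
    refine Tendsto.congr' ?_ (hw (f.comp (T.symm : Y →L[ℝ] X)))
    filter_upwards [hev] with m hm
    rw [hm]; rfl
  have hxb : ∀ m, ‖xs m‖ ≤ σ / 4 := fun m => by
    simp only [xs]
    split_ifs with h
    · exact h
    · simpa using by positivity
  have key := hps (c⁻¹ • T.symm y) (fun m => c⁻¹ • xs m) (by
    rw [map_smul_eq_mul, hpy, hy, mul_one, Real.norm_of_nonneg (by positivity)]
    exact inv_lt_one_of_one_lt₀ hc1) (hxs.smul _) (fun m => by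
    rw [norm_smul, Real.norm_of_nonneg (by positivity)]
    refine (mul_le_of_le_one_left (norm_nonneg _) (inv_le_one_of_one_le₀ hc1.le)).trans (hxb m))
  filter_upwards [key, hev] with m hm hm'
  rw [hm', ← smul_add, map_smul_eq_mul, ← map_add, hpy, Real.norm_of_nonneg (by positivity),
    inv_mul_le_iff₀ hc0] at hm
  refine hm.trans (le_of_eq ?_)
  rw [hc, div_mul_cancel₀ _ hr.ne']

theorem phi_zero [CompleteSpace X] : phi X 0 = 0 := by
  obtain ⟨Y, _, _, _, T, hT, hd⟩ := exists_renorming (normSeminorm ℝ X) one_pos (b := 1)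
    (by norm_num) (fun x => by simp)
  refine le_antisymm ((phi_le_rho hd _).trans (sInf_le ?_)) bot_le
  intro y ys hy _ hl
  rw [add_zero, ← ENNReal.ofReal_one]
  refine limsup_enorm_le zero_le_one fun s hs => ?_
  filter_upwards [eventually_norm_lt_of_limsup hl (sub_pos.2 hs) (sub_pos.2 hs)] with m hm
  have := norm_add_le y (ys m)
  linarith

theorem dominates_inv_N_phi [CompleteSpace X] :
    Dominates 100 (fun σ => ((N X σ : ℝ≥0∞))⁻¹) (phi X) := by
  intro t ht _
  rcases ht.eq_or_lt with rfl | ht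
  · simp [phi_zero]
  have key : ∀ n : ℕ, ((n + 1 : ℕ) : ℕ∞) ≤ N X t → phi X (t / 100) ≤ (((n + 1 : ℕ) : ℝ≥0∞))⁻¹ :=
    fun n hn => phi_le_inv_of_zero_mem_gameSet ht (by omega) (zero_mem_gameSet_of_le_N ht.le hn)
  dsimp only
  generalize N X t = M at key ⊢
  induction M using ENat.recTopCoe with
  | top =>
    simp only [le_top, forall_const] at key
    have h1 : Tendsto (fun n : ℕ => (((n + 1 : ℕ) : ℝ≥0∞))⁻¹) atTop (𝓝 0) :=
      (tendsto_add_atTop_iff_nat 1).2 ENNReal.tendsto_inv_nat_nhds_zero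
    simpa using ge_of_tendsto' h1 key
  | coe M =>
    rcases M with _ | M
    · simp
    · simpa using key M le_rfl

end Smooth

end Szlenk

namespace Szlenk

/-! ### Following a branch: `1/N` is dominated by `phi`. -/

section Branches

variable {X : Type u} [NormedAddCommGroup X] [NormedSpace ℝ X]

theorem neBot_succ_filter {S : Set (Finset ℕ)} (hS : IsFullTree S) {a : Finset ℕ} (ha : a ∈ S) :
    (atTop ⊓ 𝓟 {m | (∀ i ∈ a, i < m) ∧ insert m a ∈ S} : Filter ℕ).NeBot := by
  rw [← frequently_mem_iff_neBot, Nat.frequently_atTop_iff_infinite]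
  intro hf
  refine hS.infinite_succ a ha ((hf.image fun m => insert m a).subset ?_)
  rintro b ⟨hb, m, hm, rfl⟩
  exact ⟨m, ⟨hm, hb⟩, rfl⟩

/-- Successor vertices can be chosen one after the other, keeping track of partial sums. -/
theorem exists_branch_of_step {Y : Type*} [AddCommMonoid Y] {S : Set (Finset ℕ)}
    (hS : IsFullTree S) (z : Finset ℕ → Y) (hz : z ∅ = 0) (P : ℕ → Y → Prop) (h0 : P 0 0)
    (hstep : ∀ k, ∀ a ∈ S, ∀ s, P k s → ∃ b ∈ S, IsSucc a b ∧ P (k + 1) (s + z b)) :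
    ∃ β, IsBranch S β ∧ ∀ k, P k (∑ i ∈ Finset.range (k + 1), z (β i)) := by
  choose! g hg1 hg2 hg3 using hstep
  let st : ℕ → Finset ℕ × Y := fun k =>
    Nat.rec (∅, 0) (fun k p => (g k p.1 p.2, p.2 + z (g k p.1 p.2))) k
  have hst : ∀ k, st (k + 1) =
    (g k (st k).1 (st k).2, (st k).2 + z (g k (st k).1 (st k).2)) := fun _ => rfl
  have key : ∀ k, (st k).1 ∈ S ∧ P k (st k).2 ∧
      (st k).2 = ∑ i ∈ Finset.range (k + 1), z (st i).1 := by
    intro k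
    induction k with
    | zero => exact ⟨hS.empty_mem, h0, by simp [st, hz]⟩
    | succ k ih =>
      obtain ⟨h1, h2, h3⟩ := ih
      refine ⟨hg1 k _ h1 _ h2, hg3 k _ h1 _ h2, ?_⟩
      rw [Finset.sum_range_succ, ← h3, hst]
  refine ⟨fun k => (st k).1, ⟨rfl, fun k => (key k).1, fun k => ?_⟩, fun k => ?_⟩
  · exact hg2 k _ (key k).1 _ (key k).2.1
  · rw [← (key k).2.2]; exact (key k).2.1

/-- If the partial sum `s` is shorter than `a`, the triangle inequality suffices because `2 * a ≤
r`. Otherwise `s` is normalised and the modulus `rho` applies, since the scaled increments have norm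
at most `t`. -/
theorem exists_succ_norm_le {Y : Type u} [NormedAddCommGroup Y] [NormedSpace ℝ Y]
    (T : X →L[ℝ] Y) {S : Set (Finset ℕ)} {x : Finset ℕ → X} {h n : ℕ} (hn : 1 ≤ n)
    (hx : IsWeaklyNullTreeMap S x h) {t a : ℝ} (ha : 0 < a) (ht : 0 ≤ t) (ht1 : t ≤ 1)
    (hxa : ∀ b ∈ S, ‖T (x b)‖ ≤ a * t)
    (hr : rho Y t < ((n : ℝ≥0∞))⁻¹) {v : Finset ℕ} (hv : v ∈ S) {r : ℝ} (hra : 2 * a ≤ r) {s : Y}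
    (hs : ‖s‖ ≤ r) : ∃ b ∈ S, IsSucc v b ∧ ‖s + T (x b)‖ ≤ r * (1 + 1 / n) := by
  have hn0 : (0 : ℝ) < n := by exact_mod_cast hn
  have hn1 : (0 : ℝ) ≤ 1 / n := by positivity
  rcases lt_or_ge ‖s‖ a with hsa | hsa
  · obtain ⟨b, hb, hvb⟩ := (hx.fullTree.infinite_succ v hv).nonempty
    refine ⟨b, hb, hvb, ?_⟩
    have h1 := norm_add_le s (T (x b))
    have h2 := hxa b hb
    nlinarith
  · obtain ⟨c, hc, hcn⟩ := sInf_lt_iff.1 hr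
    have hs0 : 0 < ‖s‖ := ha.trans_le hsa
    set F : Filter ℕ := atTop ⊓ 𝓟 {m | (∀ i ∈ v, i < m) ∧ insert m v ∈ S} with hF
    have : F.NeBot := neBot_succ_filter hx.fullTree hv
    obtain ⟨u, hu⟩ := exists_seq_tendsto F
    have hmem : ∀ᶠ i in atTop, (∀ j ∈ v, j < u i) ∧ insert (u i) v ∈ S :=
      hu.eventually (mem_inf_of_right (mem_principal_self _))
    let ys : ℕ → Y := fun i => ‖s‖⁻¹ • T (x (insert (u i) v))
    have h1 : ∀ f : StrongDual ℝ Y, Tendsto (fun i => f (ys i)) atTop (𝓝 0) := fun f => by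
      have := ((hx.weaklyNull v hv (f.comp T)).comp hu).const_mul ‖s‖⁻¹
      simpa [ys, Function.comp_def] using this
    have h2 : limsup (fun i => ‖ys i‖ₑ) atTop ≤ ENNReal.ofReal t := by
      refine limsup_le_of_le (by isBoundedDefault) ?_
      filter_upwards [hmem] with i hi
      rw [← ofReal_norm]
      refine ENNReal.ofReal_le_ofReal ?_
      rw [norm_smul, norm_inv, norm_norm, inv_mul_le_iff₀ hs0]
      exact (hxa _ hi.2).trans (by gcongr)
    have h3 := hc (‖s‖⁻¹ • s) ys (by rw [norm_smul, norm_inv, norm_norm, inv_mul_cancel₀ hs0.ne'])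
      h1 h2
    have e : 1 + ((n : ℝ≥0∞))⁻¹ = ENNReal.ofReal (1 + 1 / n) := by
      rw [ENNReal.ofReal_add zero_le_one (by positivity), one_div, ENNReal.ofReal_inv_of_pos hn0]
      simp
    have h4 := h3.trans_lt (ENNReal.add_lt_add_left ENNReal.one_ne_top hcn)
    obtain ⟨i, hi, hiS⟩ := ((eventually_lt_of_limsup_lt h4).and hmem).exists
    refine ⟨_, hiS.2, ⟨u i, hiS.1, rfl⟩, ?_⟩
    rw [e, ← ofReal_norm, ENNReal.ofReal_lt_ofReal_iff (by positivity), ← smul_add, norm_smul,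
      norm_inv, norm_norm, inv_mul_lt_iff₀ hs0] at hi
    exact hi.le.trans (by gcongr)

theorem one_add_inv_pow_le {n : ℕ} (hn : 1 ≤ n) : (1 + 1 / (n : ℝ)) ^ (n + 1) ≤ 6 := by
  have hn0 : (0 : ℝ) < n := by exact_mod_cast hn
  have hn1 : (1 : ℝ) ≤ n := by exact_mod_cast hn
  have h1 : (1 + 1 / (n : ℝ)) ^ n ≤ Real.exp 1 := by
    have h := Real.add_one_le_exp (1 / (n : ℝ))
    calc (1 + 1 / (n : ℝ)) ^ n ≤ (Real.exp (1 / n)) ^ n := by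
          refine pow_le_pow_left₀ (by positivity) (by linarith) n
      _ = Real.exp 1 := by rw [← Real.exp_nat_mul]; congr 1; field_simp
  have h2 : 1 / (n : ℝ) ≤ 1 := by rw [div_le_one hn0]; exact hn1
  have h3 := Real.exp_one_lt_d9
  rw [pow_succ]
  have h4 : (0 : ℝ) ≤ (1 + 1 / (n : ℝ)) ^ n := by positivity
  nlinarith

/-- Otherwise some branch has partial sums in `Y` of norm at most `2 * a * (1 + 1/n) ^ k`, hence at
most `12 * a` at `k = n + 1`; pulled back to `X` the sum has norm at most 1. -/
theorem inv_le_rho_of_treeMap {Y : Type u} [NormedAddCommGroup Y] [NormedSpace ℝ Y]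
    (T : X ≃L[ℝ] Y) (hT : ‖(T : X →L[ℝ] Y)‖ * ‖(T.symm : Y →L[ℝ] X)‖ ≤ 3) {t : ℝ} (ht : 0 ≤ t)
    (ht1 : t ≤ 1) {S : Set (Finset ℕ)} {x : Finset ℕ → X} {n : ℕ}
    (hx : IsWeaklyNullTreeMap S x (n + 1)) (hxt : ∀ a ∈ S, ‖x a‖ ≤ t / 100)
    (hsum : ∀ β, IsBranch S β → 1 < ‖∑ k ∈ Finset.range (n + 2), x (β k)‖) :
    ((n : ℝ≥0∞))⁻¹ ≤ rho Y t := by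
  rcases Nat.eq_zero_or_pos n with rfl | hn
  · exfalso
    obtain ⟨β, hβ, -⟩ := exists_branch_of_step hx.fullTree x hx.map_empty (fun _ _ => True) trivial
      (fun k a ha s _ => by
        obtain ⟨b, hb, hab⟩ := (hx.fullTree.infinite_succ a ha).nonempty
        exact ⟨b, hb, hab, trivial⟩)
    have h1 := hsum β hβ
    have h2 := hxt _ (hβ.mem 1)
    rw [Finset.sum_range_succ, Finset.sum_range_one, hβ.zero, hx.map_empty, zero_add] at h1
    linarith
  by_contra! hr
  -- The choice `12 * a * ‖T.symm‖ = 1` gives `‖T‖ ≤ 36 * a`. The case of a zero inverse is that of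
  -- a trivial space.
  obtain ⟨a, ha, ha1, ha2⟩ : ∃ a : ℝ, 0 < a ∧ ‖(T : X →L[ℝ] Y)‖ ≤ 100 * a ∧
      12 * a * ‖(T.symm : Y →L[ℝ] X)‖ ≤ 1 := by
    rcases (norm_nonneg (T.symm : Y →L[ℝ] X)).eq_or_lt with h | h
    · refine ⟨‖(T : X →L[ℝ] Y)‖ + 1, by positivity, ?_, by rw [← h]; simp⟩
      linarith [norm_nonneg (T : X →L[ℝ] Y)]
    · refine ⟨(12 * ‖(T.symm : Y →L[ℝ] X)‖)⁻¹, by positivity, ?_, le_of_eq (by field_simp)⟩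
      rw [← div_eq_mul_inv, le_div_iff₀ (by positivity)]
      linarith
  have hxa : ∀ b ∈ S, ‖(T : X →L[ℝ] Y) (x b)‖ ≤ a * t := fun b hb => by
    refine ((T : X →L[ℝ] Y).le_opNorm _).trans ?_
    calc ‖(T : X →L[ℝ] Y)‖ * ‖x b‖ ≤ (100 * a) * (t / 100) := by
          gcongr; exact hxt b hb
      _ = a * t := by ring
  obtain ⟨β, hβ, hP⟩ := exists_branch_of_step hx.fullTree (fun b => (T : X →L[ℝ] Y) (x b))
    (by rw [hx.map_empty, map_zero]) (fun k s => ‖s‖ ≤ 2 * a * (1 + 1 / (n : ℝ)) ^ k)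
    (by simpa using ha.le)
    (fun k v hv s hs => by
      obtain ⟨b, hb, hvb, hle⟩ := exists_succ_norm_le (T : X →L[ℝ] Y) hn hx ha ht ht1 hxa hr hv
        (r := 2 * a * (1 + 1 / (n : ℝ)) ^ k)
        (le_mul_of_one_le_right (by positivity) (one_le_pow₀ (by
          have : (0 : ℝ) ≤ 1 / n := by positivity
          linarith))) hs
      refine ⟨b, hb, hvb, hle.trans (le_of_eq ?_)⟩
      rw [pow_succ]; ring)
  have h1 := hsum β hβ
  have h2 := hP (n + 1)
  rw [← map_sum] at h2
  have h3 := (T.symm : Y →L[ℝ] X).le_opNorm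
    ((T : X →L[ℝ] Y) (∑ k ∈ Finset.range (n + 2), x (β k)))
  simp only [ContinuousLinearEquiv.coe_coe, ContinuousLinearEquiv.symm_apply_apply] at h3 h2
  have h5 := one_add_inv_pow_le hn
  have h6 : ‖T (∑ k ∈ Finset.range (n + 2), x (β k))‖ ≤ 12 * a := by
    refine h2.trans ?_
    nlinarith
  have h7 := mul_le_mul_of_nonneg_left h6 (norm_nonneg (T.symm : Y →L[ℝ] X))
  linarith

theorem dominates_phi_inv_N : Dominates 100 (phi X) (fun σ => ((N X σ : ℝ≥0∞))⁻¹) := by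
  intro t ht ht1
  refine le_sInf ?_
  rintro _ ⟨Y, _, _, _, hd, rfl⟩
  obtain ⟨T, hT⟩ := exists_equiv_of_bmDist_le hd
  dsimp only
  by_cases h : ∃ n : ℕ, ∃ (S : Set (Finset ℕ)) (x : Finset ℕ → X),
      IsWeaklyNullTreeMap S x (n + 1) ∧ (∀ a ∈ S, ‖x a‖ ≤ t / 100) ∧
      ∀ β, IsBranch S β → 1 < ‖∑ k ∈ Finset.range (n + 2), x (β k)‖
  · classical
    have h1 : ((Nat.find h : ℕ) : ℕ∞) ≤ N X (t / 100) :=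
      le_iInf₂ fun m hm => by exact_mod_cast Nat.find_min' h hm
    obtain ⟨S, x, hx, hxt, hs⟩ := Nat.find_spec h
    refine le_trans ?_ (inv_le_rho_of_treeMap T hT ht ht1 hx hxt hs)
    rw [ENNReal.inv_le_inv]
    exact_mod_cast (ENat.toENNReal_le.2 h1)
  · have h1 : N X (t / 100) = ⊤ := iInf₂_eq_top.2 fun n hn => absurd ⟨n, hn⟩ h
    simp [h1]

end Branches

end Szlenk

namespace Szlenk

open WeakDual StrongDual

/-! ### Weak* properties of the derivations. -/

section Derivations

variable {X : Type u} [NormedAddCommGroup X] [NormedSpace ℝ X] {ε : ℝ}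

theorem tendsto_weakDual_iff {ι : Type*} {l : Filter ι} {g : ι → WeakDual ℝ X}
    {f : WeakDual ℝ X} : Tendsto g l (𝓝 f) ↔ ∀ x, Tendsto (fun i => g i x) l (𝓝 (f x)) :=
  tendsto_iff_forall_eval_tendsto_topDualPairing

theorem dualBall_eq : dualBall X = toStrongDual ⁻¹' Metric.closedBall (0 : StrongDual ℝ X) 1 := by
  ext f; simp [dualBall]

theorem isClosed_dualBall : IsClosed (dualBall X) := by
  rw [dualBall_eq]; exact WeakDual.isClosed_closedBall 0 1

theorem isCompact_dualBall : IsCompact (dualBall X) := by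
  rw [dualBall_eq]; exact WeakDual.isCompact_closedBall 0 1

theorem convex_dualBall : Convex ℝ (dualBall X) := by
  rw [dualBall_eq]
  exact (convex_closedBall (0 : StrongDual ℝ X) 1).linear_preimage
    (toStrongDual : WeakDual ℝ X ≃ₗ[ℝ] StrongDual ℝ X).toLinearMap

theorem iota_subset (ε : ℝ) (K : Set (WeakDual ℝ X)) : iota ε K ⊆ K := Set.sdiff_subset

theorem iotaHat_subset {K L : Set (WeakDual ℝ X)} (h : iota ε K ⊆ L) (hc : Convex ℝ L)
    (hL : IsClosed L) : iotaHat ε K ⊆ L :=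
  closure_minimal (convexHull_min h hc) hL

theorem iota_subset_iotaHat (ε : ℝ) (K : Set (WeakDual ℝ X)) : iota ε K ⊆ iotaHat ε K :=
  (subset_convexHull ℝ _).trans subset_closure

theorem der_succ (n : ℕ) : der X ε (n + 1) = iotaHat ε (der X ε n) :=
  Function.iterate_succ_apply' _ _ _

theorem isClosed_der (n : ℕ) : IsClosed (der X ε n) := by
  cases n with
  | zero => exact isClosed_dualBall
  | succ n => rw [der_succ]; exact isClosed_closure

theorem convex_der (n : ℕ) : Convex ℝ (der X ε n) := by
  cases n with
  | zero => exact convex_dualBall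
  | succ n => rw [der_succ]; exact (convex_convexHull ℝ _).closure

theorem der_antitone : Antitone (der X ε) := by
  refine antitone_nat_of_succ_le fun n => ?_
  rw [der_succ]
  exact iotaHat_subset (iota_subset _ _) (convex_der n) (isClosed_der n)

theorem der_subset_dualBall (n : ℕ) : der X ε n ⊆ dualBall X := der_antitone (Nat.zero_le n)

/-- A point of `K` which can be approached from `K` at distance more than `ε` survives. -/
theorem mem_iota_of_frequently (hε : 0 ≤ ε) {K : Set (WeakDual ℝ X)} {f : WeakDual ℝ X}
    {ι : Type*} {l : Filter ι} {g : ι → WeakDual ℝ X} (hf : f ∈ K) (hg : Tendsto g l (𝓝 f))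
    (hK : ∃ᶠ i in l, g i ∈ K ∧ ε < ‖toStrongDual (g i - f)‖) : f ∈ iota ε K := by
  refine ⟨hf, ?_⟩
  rintro ⟨V, ⟨hV, hd⟩, hfV⟩
  obtain ⟨i, ⟨h1, h2⟩, h3⟩ := (hK.and_eventually (hg.eventually (hV.mem_nhds hfV))).exists
  have h5 : g i ∈ V ∩ K := ⟨h3, h1⟩
  have h6 : f ∈ V ∩ K := ⟨hfV, hf⟩
  have h4 := (Metric.edist_le_ediam_of_mem (Set.mem_image_of_mem toStrongDual h5)
    (Set.mem_image_of_mem toStrongDual h6)).trans hd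
  rw [edist_eq_enorm_sub, ← map_sub, ← ofReal_norm, ENNReal.ofReal_le_ofReal_iff hε] at h4
  exact h4.not_gt h2

/-- A surviving point is a weak* limit of a separated sequence. -/
theorem exists_seq_of_mem_iota [TopologicalSpace.SeparableSpace X] {K : Set (WeakDual ℝ X)}
    (hKB : K ⊆ dualBall X) {f : WeakDual ℝ X} (hf : f ∈ iota ε K) :
    ∃ g : ℕ → WeakDual ℝ X, (∀ i, g i ∈ K) ∧ Tendsto g atTop (𝓝 f) ∧
      ∀ i, ε / 2 ≤ ‖toStrongDual (g i - f)‖ := by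
  have := WeakDual.metrizable_of_isCompact ℝ X (dualBall X) isCompact_dualBall
  let A : Set (dualBall X) := {g | (g : WeakDual ℝ X) ∈ K ∧
    ε / 2 ≤ ‖toStrongDual ((g : WeakDual ℝ X) - f)‖}
  have hcl : (⟨f, hKB hf.1⟩ : dualBall X) ∈ closure A := by
    rw [Topology.IsInducing.subtypeVal.closure_eq_preimage_closure_image, Set.mem_preimage,
      mem_closure_iff]
    intro V hV hfV
    -- If `V ∩ K` stays within `ε / 2` of `f`, its diameter is at most `ε` and `f` would have been
    -- removed.
    by_contra hne
    refine hf.2 ⟨V, ⟨hV, ?_⟩, hfV⟩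
    have hlt : ∀ g ∈ V ∩ K, ‖toStrongDual (g - f)‖ < ε / 2 := by
      intro g hg
      by_contra! hge
      exact hne ⟨g, hg.1, ⟨g, hKB hg.2⟩, ⟨hg.2, hge⟩, rfl⟩
    refine Metric.ediam_le ?_
    rintro _ ⟨g, hg, rfl⟩ _ ⟨h, hh, rfl⟩
    rw [edist_eq_enorm_sub, ← ofReal_norm]
    refine ENNReal.ofReal_le_ofReal ?_
    have e : toStrongDual g - toStrongDual h = toStrongDual (g - f) - toStrongDual (h - f) := by
      simp
    rw [e]
    linarith [norm_sub_le (toStrongDual (g - f)) (toStrongDual (h - f)), hlt g hg, hlt h hh]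
  obtain ⟨g, hg, hgl⟩ := mem_closure_iff_seq_limit.1 hcl
  exact ⟨fun i => g i, fun i => (hg i).1, (continuous_subtype_val.tendsto _).comp hgl,
    fun i => (hg i).2⟩

end Derivations

/-! ### Shrinking of the derivatives: `psi` is dominated by `H`. -/

section Upper

variable {X : Type u} [NormedAddCommGroup X] [NormedSpace ℝ X]
  {Y : Type u} [NormedAddCommGroup Y] [NormedSpace ℝ Y]

/-- Transport of functionals along an isomorphism. -/
def transport (T : X ≃L[ℝ] Y) (f : WeakDual ℝ X) : StrongDual ℝ Y :=
  (toStrongDual f).comp (T.symm : Y →L[ℝ] X)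

theorem transport_add (T : X ≃L[ℝ] Y) (f g : WeakDual ℝ X) :
    transport T (f + g) = transport T f + transport T g := rfl

theorem transport_sub (T : X ≃L[ℝ] Y) (f g : WeakDual ℝ X) :
    transport T (f - g) = transport T f - transport T g := rfl

theorem norm_transport_le (T : X ≃L[ℝ] Y) (f : WeakDual ℝ X) :
    ‖transport T f‖ ≤ ‖toStrongDual f‖ * ‖(T.symm : Y →L[ℝ] X)‖ :=
  ContinuousLinearMap.opNorm_comp_le _ _

theorem norm_le_transport (T : X ≃L[ℝ] Y) (f : WeakDual ℝ X) :
    ‖toStrongDual f‖ ≤ ‖transport T f‖ * ‖(T : X →L[ℝ] Y)‖ := by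
  have : toStrongDual f = (transport T f).comp (T : X →L[ℝ] Y) := by
    ext x; simp [transport]
  rw [this]
  exact ContinuousLinearMap.opNorm_comp_le _ _

/-- Written through single evaluations, the ball of the transported norm is seen to be weak* closed.
-/
theorem transport_ball_eq (T : X ≃L[ℝ] Y) {r : ℝ} (hr : 0 ≤ r) :
    {f : WeakDual ℝ X | ‖transport T f‖ ≤ r} =
      ⋂ y : Y, (fun f : WeakDual ℝ X => f (T.symm y)) ⁻¹' Metric.closedBall 0 (r * ‖y‖) := by
  ext f
  simp only [Set.mem_ofPred_eq, Set.mem_iInter, Set.mem_preimage, mem_closedBall_zero_iff]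
  rw [ContinuousLinearMap.opNorm_le_iff hr]
  rfl

theorem isClosed_transport_ball (T : X ≃L[ℝ] Y) (r : ℝ) :
    IsClosed {f : WeakDual ℝ X | ‖transport T f‖ ≤ r} := by
  rcases le_or_gt 0 r with hr | hr
  · rw [transport_ball_eq T hr]
    exact isClosed_iInter fun y => Metric.isClosed_closedBall.preimage
      (WeakDual.eval_continuous _)
  · convert isClosed_empty
    exact Set.eq_empty_of_forall_notMem fun f hf => (hf.trans_lt hr).not_ge (norm_nonneg _)

theorem convex_transport_ball (T : X ≃L[ℝ] Y) (r : ℝ) :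
    Convex ℝ {f : WeakDual ℝ X | ‖transport T f‖ ≤ r} := by
  let L : WeakDual ℝ X →ₗ[ℝ] StrongDual ℝ Y :=
    { toFun := transport T, map_add' := transport_add T, map_smul' := fun _ _ => rfl }
  have : {f : WeakDual ℝ X | ‖transport T f‖ ≤ r} = L ⁻¹' Metric.closedBall 0 r := by
    ext f; simp [L]; rfl
  rw [this]
  exact (convex_closedBall (0 : StrongDual ℝ Y) r).linear_preimage L

/-- The lower estimate defining `θ` for functionals of norm at most `1`. -/
theorem norm_le_sub_of_theta [Nontrivial Y] {τ : ℝ} {c : NNReal}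
    (hc : ∀ (f : StrongDual ℝ Y) (fs : ℕ → StrongDual ℝ Y), ‖f‖ = 1 →
      Tendsto (fun n => StrongDual.toWeakDual (fs n)) atTop (𝓝 0) →
      ENNReal.ofReal τ ≤ liminf (fun n => ‖fs n‖ₑ) atTop →
      1 + (c : ℝ≥0∞) ≤ liminf (fun n => ‖f + fs n‖ₑ) atTop)
    {f : StrongDual ℝ Y} {gs : ℕ → StrongDual ℝ Y} {r : ℝ} (hf : ‖f‖ ≤ 1)
    (hg : Tendsto (fun n => StrongDual.toWeakDual (gs n)) atTop (𝓝 0))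
    (hτ : ∀ n, τ ≤ ‖gs n‖) (hr : ∀ n, ‖f + gs n‖ ≤ r) : ‖f‖ ≤ r - c := by
  obtain ⟨v, hv, hfv⟩ : ∃ v : StrongDual ℝ Y, ‖v‖ = 1 ∧ f = ‖f‖ • v := by
    by_cases h : f = 0
    · obtain ⟨v, hv, -⟩ := exists_dual_vector' ℝ (0 : Y)
      exact ⟨v, hv, by simp [h]⟩
    · have h' := norm_ne_zero_iff.2 h
      refine ⟨‖f‖⁻¹ • f, ?_, (smul_inv_smul₀ h' f).symm⟩
      rw [norm_smul, norm_inv, norm_norm, inv_mul_cancel₀ h']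
  have h1 := hc v gs hv hg (le_liminf_of_le (by isBoundedDefault) (Eventually.of_forall fun n => by
    rw [← ofReal_norm]; exact ENNReal.ofReal_le_ofReal (hτ n)))
  have h2 : ∀ n, ‖v + gs n‖ ≤ r + (1 - ‖f‖) := fun n => by
    -- Passing from `f` to the unit vector `v` costs `1 - ‖f‖`, which turns `1 + c ≤ r + (1 - ‖f‖)`
    -- into the claim.
    have e : v + gs n = (‖f‖ • v + gs n) + (1 - ‖f‖) • v := by module
    rw [← hfv] at e
    rw [e]
    refine (norm_add_le _ _).trans (add_le_add (hr n) ?_)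
    rw [norm_smul, hv, mul_one, Real.norm_of_nonneg (by linarith)]
  have h3 : liminf (fun n => ‖v + gs n‖ₑ) atTop ≤ ENNReal.ofReal (r + (1 - ‖f‖)) := by
    refine liminf_le_of_le (by isBoundedDefault) fun b hb => ?_
    obtain ⟨n, hn⟩ := hb.exists
    refine hn.trans ?_
    rw [← ofReal_norm]; exact ENNReal.ofReal_le_ofReal (h2 n)
  have h4 := h1.trans h3
  have e : (1 : ℝ≥0∞) + c = ENNReal.ofReal (1 + c) := by
    rw [ENNReal.ofReal_add zero_le_one (NNReal.coe_nonneg c)]; simp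
  rw [e, ENNReal.ofReal_le_ofReal_iff (by
    have := (norm_nonneg _).trans (h2 0)
    exact this)] at h4
  linarith

/-- By induction the `j`-th derivative lies in the transported ball of radius `b * (1 - j * c)`: a
surviving point is the limit of a separated sequence from that ball, so its norm is smaller by `b *
c`. This ball is convex and weak* closed, so it contains `iotaHat` too. -/
theorem mul_le_one_of_der_nonempty [TopologicalSpace.SeparableSpace X] [Nontrivial X]
    (T : X ≃L[ℝ] Y) (hT : ‖(T : X →L[ℝ] Y)‖ * ‖(T.symm : Y →L[ℝ] X)‖ ≤ 3) {t : ℝ} (ht : 0 ≤ t)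
    {c : NNReal} (hc : ∀ (f : StrongDual ℝ Y) (fs : ℕ → StrongDual ℝ Y), ‖f‖ = 1 →
      Tendsto (fun n => StrongDual.toWeakDual (fs n)) atTop (𝓝 0) →
      ENNReal.ofReal (t / 100) ≤ liminf (fun n => ‖fs n‖ₑ) atTop →
      1 + (c : ℝ≥0∞) ≤ liminf (fun n => ‖f + fs n‖ₑ) atTop)
    {n : ℕ} (hn : (der X t n).Nonempty) : n * (c : ℝ) ≤ 1 := by
  have : Nontrivial Y := T.symm.toEquiv.nontrivial
  set b := ‖(T.symm : Y →L[ℝ] X)‖ with hb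
  have hb0 : 0 < b := T.symm.norm_pos
  have key : ∀ j, der X t j ⊆ {f | ‖transport T f‖ ≤ b * (1 - j * c)} := by
    intro j
    induction j with
    | zero =>
      intro f hf
      have h1 : ‖toStrongDual f‖ ≤ 1 := hf
      have h2 := norm_transport_le T f
      simp only [Nat.cast_zero, zero_mul, sub_zero, mul_one, Set.mem_ofPred_eq]
      nlinarith
    | succ j ih =>
      rw [der_succ]
      refine iotaHat_subset ?_ (convex_transport_ball T _) (isClosed_transport_ball T _)
      intro f hf
      obtain ⟨g, hgK, hgf, hgt⟩ := exists_seq_of_mem_iota (der_subset_dualBall j) hf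
      have h0 : ∀ h : StrongDual ℝ Y, ‖b⁻¹ • h‖ = b⁻¹ * ‖h‖ := fun h => by
        rw [norm_smul, Real.norm_of_nonneg (by positivity)]
      have hj : ‖transport T f‖ ≤ b := by
        have h1 : ‖transport T f‖ ≤ b * (1 - j * c) := ih hf.1
        have h2 : (0 : ℝ) ≤ j * c := by positivity
        nlinarith
      have key := norm_le_sub_of_theta hc (f := b⁻¹ • transport T f)
        (gs := fun i => b⁻¹ • transport T (g i - f)) (r := 1 - j * c) ?_ ?_ ?_ ?_
      · rw [h0, inv_mul_le_iff₀ hb0] at key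
        refine key.trans (le_of_eq ?_)
        push_cast; ring
      · rw [h0, inv_mul_le_iff₀ hb0]; linarith
      · rw [tendsto_weakDual_iff]
        intro y
        have h2 := ((tendsto_weakDual_iff.1 hgf (T.symm y)).sub_const (f (T.symm y))).const_mul b⁻¹
        rw [sub_self, mul_zero] at h2
        exact h2
      · intro i
        rw [h0]
        -- Separation `t / 2` in `X*` becomes at least `t / 6` after transport and scaling, which
        -- exceeds the needed `t / 100`.
        have h1 := (hgt i).trans (norm_le_transport T (g i - f))
        rw [← div_eq_inv_mul, le_div_iff₀ hb0]
        have h2 : ‖transport T (g i - f)‖ * ‖(T : X →L[ℝ] Y)‖ * b ≤ ‖transport T (g i - f)‖ * 3 := by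
          rw [mul_assoc]; gcongr
        nlinarith
      · intro i
        rw [transport_sub, ← smul_add, add_sub_cancel, h0, inv_mul_le_iff₀ hb0]
        exact ih (hgK i)
  obtain ⟨f, hf⟩ := hn
  have h1 := (norm_nonneg _).trans (key n hf)
  have h2 := nonneg_of_mul_nonneg_right h1 hb0
  linarith

theorem dominates_H_psi [TopologicalSpace.SeparableSpace X] [Nontrivial X] :
    Dominates 100 (H X) (psi X) := by
  intro t ht _
  refine sSup_le ?_
  rintro _ ⟨Y, _, _, _, hd, rfl⟩
  obtain ⟨T, hT⟩ := exists_equiv_of_bmDist_le hd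
  -- An admissible `c` might be infinite, so it is approached by finite constants.
  refine sSup_le fun c hc => ENNReal.le_of_forall_nnreal_lt fun c' hc' => ?_
  have key : ∀ n : ℕ, (der X t n).Nonempty → (c' : ℝ≥0∞) ≤ ((n : ℝ≥0∞))⁻¹ := by
    intro n hn
    have h1 := mul_le_one_of_der_nonempty T hT ht (c := c')
      (fun f fs h1 h2 h3 => le_trans (by gcongr) (hc f fs h1 h2 h3)) hn
    rw [ENNReal.le_inv_iff_mul_le, mul_comm]
    exact_mod_cast h1
  rcases Cz_eq_top_or (X := X) (ε := t) with h | ⟨n, h1, h2, -⟩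
  · rw [H_eq_zero h]
    exact ge_of_tendsto' ENNReal.tendsto_inv_nat_nhds_zero fun n =>
      key n (der_nonempty_of_lt_Cz (by rw [h]; exact WithTop.coe_lt_top n))
  · rw [H_eq_inv h1]; exact key n h2

end Upper

end Szlenk

namespace Szlenk

open WeakDual StrongDual

/-! ### Limits along ultrafilters, along which all bounded data converge simultaneously. -/

section Limits

theorem exists_ultrafilter_limit {ι E : Type*} [TopologicalSpace E] {K : Set E} (hK : IsCompact K)
    {u : ι → E} (l : Ultrafilter ι) (hu : ∀ i, u i ∈ K) :
    ∃ x ∈ K, Tendsto u l (𝓝 x) := by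
  refine hK.ultrafilter_le_nhds (l.map u) ?_
  rw [le_principal_iff]
  exact Filter.mem_map.2 (Filter.univ_mem' hu)

variable {X : Type u} [NormedAddCommGroup X] [NormedSpace ℝ X]

theorem norm_le_of_tendsto {ι : Type*} {l : Filter ι} [l.NeBot] {g : ι → WeakDual ℝ X}
    {f : WeakDual ℝ X} {c : ℝ} (hg : Tendsto g l (𝓝 f))
    (hc : Tendsto (fun i => ‖toStrongDual (g i)‖) l (𝓝 c)) : ‖toStrongDual f‖ ≤ c := by
  refine ContinuousLinearMap.opNorm_le_bound _ (ge_of_tendsto' hc fun _ => norm_nonneg _) ?_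
  intro x
  exact le_of_tendsto_of_tendsto' ((tendsto_weakDual_iff.1 hg x).norm) (hc.mul_const ‖x‖)
    fun i => (toStrongDual (g i)).le_opNorm x

theorem exists_norm_limit {ι : Type*} (l : Ultrafilter ι) {g : ι → WeakDual ℝ X} {r : ℝ}
    (hg : ∀ i, ‖toStrongDual (g i)‖ ≤ r) :
    ∃ c, Tendsto (fun i => ‖toStrongDual (g i)‖) l (𝓝 c) := by
  obtain ⟨c, -, hc⟩ := exists_ultrafilter_limit (isCompact_Icc (a := 0) (b := r)) l
    (u := fun i => ‖toStrongDual (g i)‖) (fun i => ⟨norm_nonneg _, hg i⟩)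
  exact ⟨c, hc⟩

end Limits

/-! ### Levels gained in weak* limits. -/

section Shift

variable {X : Type u} [NormedAddCommGroup X] [NormedSpace ℝ X] {ε : ℝ}

/-- A limit of points of the `j`-th derivative at distance more than `m ε` belongs to the
`j + m`-th derivative. -/
theorem mem_der_add (hε : 0 ≤ ε) {ι : Type*} {l : Filter ι} [l.NeBot] {j m : ℕ}
    {g : ι → WeakDual ℝ X} {f : WeakDual ℝ X} (hg : ∀ i, g i ∈ der X ε j)
    (hgf : Tendsto g l (𝓝 f)) (hm : ∀ᶠ i in l, m * ε < ‖toStrongDual (g i - f)‖) :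
    f ∈ der X ε (j + m) := by
  have hf : f ∈ der X ε j := (isClosed_der j).mem_of_tendsto hgf (Eventually.of_forall hg)
  rcases Nat.eq_zero_or_pos m with rfl | hm0
  · exact hf
  have hm1 : (0 : ℝ) < m := by exact_mod_cast hm0
  -- A jump longer than `m * ε` is cut into `m` steps: in the combination, one share `1 / m` of `g
  -- k` at a time is replaced by `f`, a move longer than `ε` which costs one derivation.
  have key : ∀ i ≤ m, ∀ z ∈ der X ε j,
      ((i : ℝ) / m) • f + (1 - (i : ℝ) / m) • z ∈ der X ε (j + i) := by
    intro i
    induction i with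
    | zero => intro _ z hz; simpa using hz
    | succ i ih =>
      intro hi z hz
      have hmi : (0 : ℝ) < (m : ℝ) - i := by
        have : (i : ℝ) + 1 ≤ m := by exact_mod_cast hi
        linarith
      have hmi1 : (1 : ℝ) ≤ (m : ℝ) - i := by
        have : (i : ℝ) + 1 ≤ m := by exact_mod_cast hi
        linarith
      have hu : ∀ y ∈ der X ε j, ((i : ℝ) / m) • f + ((1 / m : ℝ) • y +
          (1 - ((i + 1 : ℕ) : ℝ) / m) • z) ∈ der X ε (j + i) := by
        intro y hy
        have hw : (1 / ((m : ℝ) - i)) • y + (1 - 1 / ((m : ℝ) - i)) • z ∈ der X ε j :=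
          convex_der j hy hz (by positivity) (by
            rw [sub_nonneg, div_le_one hmi]; exact hmi1) (by ring)
        have := ih (by omega) _ hw
        convert this using 2
        rw [smul_add, smul_smul, smul_smul]
        congr 2
        · field_simp
        · push_cast; field_simp; ring
      rw [← add_assoc, der_succ]
      apply iota_subset_iotaHat
      have e : (((i + 1 : ℕ) : ℝ) / m) • f + (1 - ((i + 1 : ℕ) : ℝ) / m) • z =
          ((i : ℝ) / m) • f + ((1 / m : ℝ) • f + (1 - ((i + 1 : ℕ) : ℝ) / m) • z) := by
        rw [← add_assoc, ← add_smul]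
        congr 2
        push_cast; ring
      rw [e]
      refine mem_iota_of_frequently hε (l := l) (g := fun k => ((i : ℝ) / m) • f +
        ((1 / m : ℝ) • g k + (1 - ((i + 1 : ℕ) : ℝ) / m) • z)) (hu f hf) ?_ ?_
      · exact tendsto_const_nhds.add ((hgf.const_smul _).add tendsto_const_nhds)
      · refine Eventually.frequently ?_
        filter_upwards [hm] with k hk
        refine ⟨hu _ (hg k), ?_⟩
        rw [add_sub_add_left_eq_sub, add_sub_add_right_eq_sub, ← smul_sub, map_smul, norm_smul,
          Real.norm_of_nonneg (by positivity), one_div, lt_inv_mul_iff₀ hm1]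
        exact hk
  have := key m le_rfl f hf
  rwa [div_self hm1.ne', sub_self, one_smul, zero_smul, add_zero] at this

/-- The convex hull of the marked derivatives. -/
def derHull (X : Type u) [NormedAddCommGroup X] [NormedSpace ℝ X] (ε : ℝ) (n : ℕ) :
    Set (WeakDual ℝ X × ℝ) :=
  convexHull ℝ (levels (der X ε) (Set.Iic n))

theorem convex_derHull (n : ℕ) : Convex ℝ (derHull X ε n) := convex_convexHull ℝ _

theorem derHull_subset (n : ℕ) :
    derHull X ε n ⊆ dualBall X ×ˢ Set.Icc 0 (n : ℝ) :=
  hull_levels_subset der_subset_dualBall convex_dualBall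

/-- The levels gained by passing to a weak* limit at distance `s`. -/
def gain (ε s : ℝ) : ℝ := max 0 (s / ε - 1)

theorem gain_combo (hε : 0 < ε) {a b s s₁ s₂ : ℝ} (ha : 0 ≤ a) (hb : 0 ≤ b) (hab : a + b = 1)
    (hs : s ≤ a * s₁ + b * s₂) : gain ε s ≤ a * gain ε s₁ + b * gain ε s₂ := by
  refine max_le ?_ ?_
  · exact add_nonneg (mul_nonneg ha (le_max_left _ _)) (mul_nonneg hb (le_max_left _ _))
  · have h1 : s / ε - 1 ≤ a * (s₁ / ε - 1) + b * (s₂ / ε - 1) := by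
      have h2 : s / ε ≤ (a * s₁ + b * s₂) / ε := by gcongr
      have h3 : (a * s₁ + b * s₂) / ε = a * (s₁ / ε) + b * (s₂ / ε) := by ring
      linarith
    exact h1.trans (add_le_add (mul_le_mul_of_nonneg_left (le_max_right _ _) ha)
      (mul_le_mul_of_nonneg_left (le_max_right _ _) hb))

/-- Limits along `l` of points of `Z` gain levels in the hull. -/
def Gains {ι : Type*} (l : Ultrafilter ι) (ε : ℝ) (n : ℕ) (Z : Set (WeakDual ℝ X × ℝ)) : Prop :=
  ∀ (g : ι → WeakDual ℝ X × ℝ) (f : WeakDual ℝ X) (b s : ℝ), (∀ i, g i ∈ Z) →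
    Tendsto (fun i => (g i).1) l (𝓝 f) → Tendsto (fun i => (g i).2) l (𝓝 b) →
    Tendsto (fun i => ‖toStrongDual ((g i).1 - f)‖) l (𝓝 s) →
    ∃ b', b + gain ε s ≤ b' ∧ (f, b') ∈ derHull X ε n

/-- For `s > ε`, the integer `m = ⌈s/ε⌉ - 1` satisfies `m * ε < s` and `m ≥ s/ε - 1`, so
`mem_der_add` gives `m` levels. No level above `n` occurs because the next derivative is empty. -/
theorem gains_level {ι : Type*} (l : Ultrafilter ι) (hε : 0 < ε) {n j : ℕ}
    (hn : der X ε (n + 1) = ∅) : Gains l ε n (der X ε j ×ˢ {(j : ℝ)}) := by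
  intro g f b s hg hgf hb hs
  have hs0 : 0 ≤ s := ge_of_tendsto' hs fun _ => norm_nonneg _
  have hbj : b = j := tendsto_nhds_unique hb (by
    simp only [fun i => Set.mem_singleton_iff.1 (hg i).2]; exact tendsto_const_nhds)
  obtain ⟨m, hms, hmf⟩ : ∃ m : ℕ, gain ε s ≤ m ∧ f ∈ der X ε (j + m) := by
    rcases le_or_gt (s / ε) 1 with h | h
    · refine ⟨0, ?_, (isClosed_der j).mem_of_tendsto hgf (Eventually.of_forall fun i => (hg i).1)⟩
      simp [gain, h]
    · have h1 := Nat.le_ceil (s / ε)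
      have h2 : 1 < ⌈s / ε⌉₊ := by exact_mod_cast h.trans_le h1
      have h3 : ((⌈s / ε⌉₊ - 1 : ℕ) : ℝ) < s / ε := Nat.lt_ceil.1 (by omega)
      refine ⟨⌈s / ε⌉₊ - 1, ?_, mem_der_add hε.le (fun i => (hg i).1) hgf ?_⟩
      · rw [Nat.cast_sub h2.le]
        refine max_le ?_ (by push_cast; linarith)
        have : (1 : ℝ) < ⌈s / ε⌉₊ := by exact_mod_cast h2
        push_cast; linarith
      · exact hs.eventually_const_lt ((lt_div_iff₀ hε).1 h3)
  refine ⟨(j + m : ℕ), ?_, mem_hull_levels (Set.mem_Iic.2 ?_) hmf⟩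
  · push_cast; linarith
  · by_contra! hlt
    have := der_antitone (ε := ε) (Nat.succ_le_of_lt hlt) hmf
    rw [Nat.succ_eq_add_one, hn] at this
    exact this

/-- The endpoints and weights converge along the ultrafilter. The limit distance is at most the
corresponding combination of the endpoint distances, and `gain` is convex and nondecreasing. -/
theorem gains_convexJoin {ι : Type*} (l : Ultrafilter ι) (hε : 0 < ε) {n : ℕ}
    {Z₁ Z₂ : Set (WeakDual ℝ X × ℝ)} (h₁ : Gains l ε n Z₁) (h₂ : Gains l ε n Z₂)
    (hZ₁ : Z₁ ⊆ dualBall X ×ˢ Set.Icc 0 (n : ℝ)) (hZ₂ : Z₂ ⊆ dualBall X ×ˢ Set.Icc 0 (n : ℝ)) :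
    Gains l ε n (convexJoin ℝ Z₁ Z₂) := by
  intro g f b s hg hgf hb hs
  have hg' : ∀ i, ∃ p q : WeakDual ℝ X × ℝ, ∃ c ∈ Set.Icc (0 : ℝ) 1, p ∈ Z₁ ∧ q ∈ Z₂ ∧
      g i = c • p + (1 - c) • q := by
    intro i
    obtain ⟨p, hp, q, hq, c, d, hc, hd, hcd, he⟩ := mem_convexJoin.1 (hg i)
    exact ⟨p, q, c, ⟨hc, by linarith⟩, hp, hq, by rw [← he, ← hcd, add_sub_cancel_left]⟩
  choose p q c hc hp hq he using hg'
  have lim : ∀ (Z : Set (WeakDual ℝ X × ℝ)) (v : ι → WeakDual ℝ X × ℝ),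
      Z ⊆ dualBall X ×ˢ Set.Icc 0 (n : ℝ) → (∀ i, v i ∈ Z) → ∃ (y : WeakDual ℝ X) (d r : ℝ),
      ‖toStrongDual y‖ ≤ 1 ∧
      Tendsto (fun i => (v i).1) l (𝓝 y) ∧ Tendsto (fun i => (v i).2) l (𝓝 d) ∧
      Tendsto (fun i => ‖toStrongDual ((v i).1 - y)‖) l (𝓝 r) := by
    intro Z v hZ hv
    obtain ⟨y, hy, hvy⟩ := exists_ultrafilter_limit isCompact_dualBall l
      (u := fun i => (v i).1) (fun i => (hZ (hv i)).1)
    obtain ⟨d, -, hvd⟩ := exists_ultrafilter_limit (isCompact_Icc (a := 0) (b := (n : ℝ))) l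
      (u := fun i => (v i).2) (fun i => (hZ (hv i)).2)
    obtain ⟨r, hr⟩ := exists_norm_limit l (g := fun i => (v i).1 - y) (r := 1 + 1) (fun i => by
      rw [map_sub]
      exact (norm_sub_le _ _).trans (add_le_add (hZ (hv i)).1 hy))
    exact ⟨y, d, r, hy, hvy, hvd, hr⟩
  obtain ⟨y₁, d₁, r₁, hy₁, hpy, hpd, hpr⟩ := lim Z₁ p hZ₁ hp
  obtain ⟨y₂, d₂, r₂, hy₂, hqy, hqd, hqr⟩ := lim Z₂ q hZ₂ hq
  obtain ⟨a, ha, hca⟩ := exists_ultrafilter_limit (isCompact_Icc (a := (0 : ℝ)) (b := 1)) l hc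
  have hca' : Tendsto (fun i => 1 - c i) l (𝓝 (1 - a)) := tendsto_const_nhds.sub hca
  have ef : f = a • y₁ + (1 - a) • y₂ := by
    refine tendsto_nhds_unique hgf (((hca.smul hpy).add (hca'.smul hqy)).congr fun i => ?_)
    rw [he]; rfl
  have eb : b = a * d₁ + (1 - a) * d₂ := by
    refine tendsto_nhds_unique hb (((hca.mul hpd).add (hca'.mul hqd)).congr fun i => ?_)
    rw [he]; rfl
  have hsr : s ≤ a * r₁ + (1 - a) * r₂ := by
    have hlim : Tendsto (fun i => c i * ‖toStrongDual ((p i).1 - y₁)‖ +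
        (1 - c i) * ‖toStrongDual ((q i).1 - y₂)‖ + (|c i - a| + |c i - a|)) l
        (𝓝 (a * r₁ + (1 - a) * r₂ + (|a - a| + |a - a|))) :=
      ((hca.mul hpr).add (hca'.mul hqr)).add
        ((hca.sub_const a).abs.add (hca.sub_const a).abs)
    rw [sub_self, abs_zero, add_zero, add_zero] at hlim
    refine le_of_tendsto_of_tendsto' hs hlim fun i => ?_
    have e : toStrongDual ((g i).1 - f) = (c i • toStrongDual ((p i).1 - y₁) +
        (1 - c i) • toStrongDual ((q i).1 - y₂)) +
        ((c i - a) • toStrongDual y₁ - (c i - a) • toStrongDual y₂) := by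
      rw [he, ef]
      simp only [Prod.fst_add, Prod.smul_fst, map_sub, map_add, map_smul]
      module
    rw [e]
    refine (norm_add_le _ _).trans (add_le_add ((norm_add_le _ _).trans ?_)
      ((norm_sub_le _ _).trans ?_))
    · rw [norm_smul, norm_smul, Real.norm_of_nonneg (hc i).1,
        Real.norm_of_nonneg (sub_nonneg.2 (hc i).2)]
    · rw [norm_smul, norm_smul, Real.norm_eq_abs]
      exact add_le_add (mul_le_of_le_one_right (abs_nonneg _) hy₁)
        (mul_le_of_le_one_right (abs_nonneg _) hy₂)
  obtain ⟨b₁, hb₁, hm₁⟩ := h₁ p y₁ d₁ r₁ hp hpy hpd hpr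
  obtain ⟨b₂, hb₂, hm₂⟩ := h₂ q y₂ d₂ r₂ hq hqy hqd hqr
  have ha1 := sub_nonneg.2 ha.2
  refine ⟨a * b₁ + (1 - a) * b₂, ?_, ?_⟩
  · have h3 := gain_combo hε ha.1 ha1 (by ring) hsr
    have h4 := mul_le_mul_of_nonneg_left hb₁ ha.1
    have h5 := mul_le_mul_of_nonneg_left hb₂ ha1
    rw [eb]; linarith
  · rw [ef]
    exact convex_derHull n hm₁ hm₂ ha.1 ha1 (by ring)

theorem hull_levels_der_singleton (j : ℕ) :
    convexHull ℝ (levels (der X ε) {j}) = der X ε j ×ˢ {(j : ℝ)} := by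
  have h : Convex ℝ (der X ε j ×ˢ ({(j : ℝ)} : Set ℝ)) :=
    Convex.prod (convex_der j) (convex_singleton (j : ℝ))
  rw [levels_singleton]
  exact h.convexHull_eq

/-- The levels are joined one at a time; at each stage the hull of a union is the convex join of the
two hulls. -/
theorem gains_derHull {ι : Type*} (l : Ultrafilter ι) (hε : 0 < ε) {n : ℕ}
    (h0 : (der X ε n).Nonempty) (hn : der X ε (n + 1) = ∅) :
    Gains l ε n (derHull X ε n) := by
  have key : ∀ k ≤ n, Gains l ε n (derHull X ε k) := by
    intro k
    induction k with
    | zero =>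
      intro _
      have e : Set.Iic 0 = {0} := by ext; simp
      rw [derHull, e, hull_levels_der_singleton]
      exact gains_level l hε hn
    | succ k ih =>
      intro hk
      have e : Set.Iic (k + 1) = Set.Iic k ∪ {k + 1} := by
        ext; simp only [Set.mem_Iic, Set.mem_union, Set.mem_singleton_iff]; omega
      obtain ⟨f, hf⟩ := h0
      have hne : ∀ j ≤ n, f ∈ der X ε j := fun j hj => der_antitone hj hf
      have hne1 : (levels (der X ε) (Set.Iic k)).Nonempty :=
        ⟨(f, ((0 : ℕ) : ℝ)), 0, Set.mem_Iic.2 (Nat.zero_le k), hne 0 (Nat.zero_le n), rfl⟩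
      have hne2 : (levels (der X ε) {k + 1}).Nonempty :=
        ⟨(f, ((k + 1 : ℕ) : ℝ)), k + 1, rfl, hne _ hk, rfl⟩
      have hcast : ((k + 1 : ℕ) : ℝ) ≤ n := by exact_mod_cast hk
      rw [derHull, e, levels_union, convexHull_union hne1 hne2, hull_levels_der_singleton]
      refine gains_convexJoin l hε (ih (by omega)) (gains_level l hε hn) ?_ ?_
      · refine (derHull_subset k).trans (Set.prod_mono Set.Subset.rfl (Set.Icc_subset_Icc_right ?_))
        exact_mod_cast (by omega : k ≤ n)
      · refine Set.prod_mono (der_subset_dualBall _) ?_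
        rintro _ rfl
        exact ⟨by positivity, hcast⟩
  exact key n le_rfl

end Shift

end Szlenk

namespace Szlenk

open WeakDual StrongDual

/-! ### A convex function on the dual built from norm and height. -/

section Sublevel

variable {X : Type u} [NormedAddCommGroup X] [NormedSpace ℝ X] {ε : ℝ} {n : ℕ}

/-- The sublevel sets of the convex function combining the norm and the levels of the
derivatives. -/
def sublevel (X : Type u) [NormedAddCommGroup X] [NormedSpace ℝ X] (ε : ℝ) (n : ℕ) (a : ℝ) :
    Set (WeakDual ℝ X) :=
  {f | ∃ b, ((1 / 2 : ℝ) • f, b) ∈ derHull X ε n ∧ ‖toStrongDual f‖ + 2 * (1 - b / n) ≤ a}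

theorem sublevel_combo {f g : WeakDual ℝ X} {a b s t : ℝ} (hf : f ∈ sublevel X ε n a)
    (hg : g ∈ sublevel X ε n b) (hs : 0 ≤ s) (ht : 0 ≤ t) (hst : s + t = 1) :
    s • f + t • g ∈ sublevel X ε n (s * a + t * b) := by
  obtain ⟨c, hc, hca⟩ := hf
  obtain ⟨d, hd, hdb⟩ := hg
  refine ⟨s * c + t * d, ?_, ?_⟩
  · have := convex_derHull n hc hd hs ht hst
    convert this using 1
    ext1
    · simp only [Prod.fst_add, Prod.smul_fst, smul_add]
      rw [smul_comm, smul_comm t]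
    · simp
  · have h1 : ‖toStrongDual (s • f + t • g)‖ ≤ s * ‖toStrongDual f‖ + t * ‖toStrongDual g‖ := by
      rw [map_add, map_smul, map_smul]
      refine (norm_add_le _ _).trans (le_of_eq ?_)
      rw [norm_smul, norm_smul, Real.norm_of_nonneg hs, Real.norm_of_nonneg ht]
    have h2 := mul_le_mul_of_nonneg_left hca hs
    have h3 := mul_le_mul_of_nonneg_left hdb ht
    have h4 : 2 * (1 - (s * c + t * d) / n) =
        s * (2 * (1 - c / n)) + t * (2 * (1 - d / n)) := by
      linear_combination -2 * hst
    rw [h4]; linarith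

theorem sublevel_mono {a b : ℝ} (h : a ≤ b) : sublevel X ε n a ⊆ sublevel X ε n b :=
  fun _ ⟨c, hc, hca⟩ => ⟨c, hc, hca.trans h⟩

theorem neg_mem_dualBall {f : WeakDual ℝ X} (hf : f ∈ dualBall X) : -f ∈ dualBall X := by
  simpa [dualBall] using hf

theorem neg_mem_iota {K : Set (WeakDual ℝ X)} (hK : ∀ f ∈ K, -f ∈ K) {f : WeakDual ℝ X}
    (hf : f ∈ iota ε K) : -f ∈ iota ε K := by
  refine ⟨hK f hf.1, ?_⟩
  rintro ⟨V, ⟨hV, hd⟩, hfV⟩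
  refine hf.2 ⟨-V, ⟨hV.neg, ?_⟩, hfV⟩
  refine le_trans (Metric.ediam_le ?_) hd
  rintro _ ⟨g, hg, rfl⟩ _ ⟨h, hh, rfl⟩
  have h1 : -g ∈ V ∩ K := ⟨hg.1, hK g hg.2⟩
  have h2 : -h ∈ V ∩ K := ⟨hh.1, hK h hh.2⟩
  have := Metric.edist_le_ediam_of_mem (Set.mem_image_of_mem toStrongDual h1)
    (Set.mem_image_of_mem toStrongDual h2)
  rwa [map_neg, map_neg, edist_neg_neg] at this

theorem neg_mem_der (j : ℕ) : ∀ f ∈ der X ε j, -f ∈ der X ε j := by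
  induction j with
  | zero => exact fun f hf => neg_mem_dualBall hf
  | succ j ih =>
    rw [der_succ]
    intro f hf
    have h1 : iota ε (der X ε j) ⊆ -iotaHat ε (der X ε j) := fun g hg =>
      iota_subset_iotaHat _ _ (neg_mem_iota ih hg)
    exact iotaHat_subset h1 ((convex_convexHull ℝ _).closure.neg) isClosed_closure.neg hf

theorem neg_mem_sublevel {a : ℝ} {f : WeakDual ℝ X} (hf : f ∈ sublevel X ε n a) :
    -f ∈ sublevel X ε n a := by
  obtain ⟨b, hb, hba⟩ := hf
  refine ⟨b, ?_, by simpa using hba⟩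
  rw [smul_neg]
  exact neg_mem_hull_levels neg_mem_der hb

theorem zero_mem_der {j : ℕ} (h : (der X ε j).Nonempty) : (0 : WeakDual ℝ X) ∈ der X ε j := by
  obtain ⟨f, hf⟩ := h
  have := convex_der j hf (neg_mem_der j f hf) (by norm_num : (0 : ℝ) ≤ 1 / 2)
    (by norm_num : (0 : ℝ) ≤ 1 / 2) (by norm_num)
  simpa using this

theorem zero_mem_sublevel (hn : 1 ≤ n) (h : (der X ε n).Nonempty) :
    (0 : WeakDual ℝ X) ∈ sublevel X ε n 0 := by
  have hn0 : (n : ℝ) ≠ 0 := by exact_mod_cast (by omega : n ≠ 0)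
  refine ⟨n, ?_, ?_⟩
  · rw [smul_zero]
    exact mem_hull_levels (Set.mem_Iic.2 le_rfl) (zero_mem_der h)
  · simp [hn0]

theorem norm_le_of_mem_sublevel (hn : 1 ≤ n) {a : ℝ} {f : WeakDual ℝ X}
    (hf : f ∈ sublevel X ε n a) : ‖toStrongDual f‖ ≤ a := by
  have hn0 : (0 : ℝ) < n := by exact_mod_cast hn
  obtain ⟨b, hb, hba⟩ := hf
  have h1 : b ≤ n := (derHull_subset n hb).2.2
  have h2 : b / n ≤ 1 := (div_le_one hn0).2 h1
  linarith

/-- The function is at most 4 on the ball of radius 2 (norm 2, height 0) and vanishes at 0, so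
convexity scales it. The factor `1 / 2` in `sublevel` is what makes radius 2 available. -/
theorem mem_sublevel_of_norm_le (hn : 1 ≤ n) (h : (der X ε n).Nonempty) {f : WeakDual ℝ X} {r : ℝ}
    (hr : 0 < r) (hr1 : r ≤ 1) (hf : ‖toStrongDual f‖ ≤ 2 * r) : f ∈ sublevel X ε n (4 * r) := by
  have h1 : r⁻¹ • f ∈ sublevel X ε n 4 := by
    have hnorm : ‖toStrongDual (r⁻¹ • f)‖ ≤ 2 := by
      rw [map_smul, norm_smul, Real.norm_of_nonneg (by positivity), inv_mul_le_iff₀ hr]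
      linarith
    refine ⟨(0 : ℕ), mem_hull_levels (Set.mem_Iic.2 (Nat.zero_le n)) ?_, ?_⟩
    · change ‖toStrongDual ((1 / 2 : ℝ) • r⁻¹ • f)‖ ≤ 1
      rw [map_smul, norm_smul, Real.norm_of_nonneg (by norm_num)]
      linarith
    · simp only [Nat.cast_zero, zero_div]; linarith
  have := sublevel_combo h1 (zero_mem_sublevel hn h) hr.le (sub_nonneg.2 hr1) (by ring)
  rw [smul_inv_smul₀ hr.ne', smul_zero, add_zero] at this
  exact sublevel_mono (by linarith) this

/-- The norm is weak* lower semicontinuous and the height gains; the distance is halved because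
heights are taken at `f / 2`. -/
theorem sublevel_limit {ι : Type*} (l : Ultrafilter ι) (hε : 0 < ε) (hn : 1 ≤ n)
    (h0 : (der X ε n).Nonempty) (h1 : der X ε (n + 1) = ∅) {a δ : ℝ} {g : ι → WeakDual ℝ X}
    {f : WeakDual ℝ X} (hg : ∀ i, g i ∈ sublevel X ε n a) (hgf : Tendsto g l (𝓝 f))
    (hδ : ∀ i, δ ≤ ‖toStrongDual (g i - f)‖) :
    f ∈ sublevel X ε n (a - 2 * gain ε (δ / 2) / n) := by
  have hn0 : (0 : ℝ) < n := by exact_mod_cast hn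
  have hga : ∀ i, ‖toStrongDual (g i)‖ ≤ a := fun i => norm_le_of_mem_sublevel hn (hg i)
  obtain ⟨c, hc⟩ := exists_norm_limit l hga
  have hfc := norm_le_of_tendsto hgf hc
  choose b hb hba using hg
  obtain ⟨d, -, hd⟩ := exists_ultrafilter_limit (isCompact_Icc (a := 0) (b := (n : ℝ))) l
    (u := b) (fun i => (derHull_subset n (hb i)).2)
  obtain ⟨s, hs⟩ := exists_norm_limit l (g := fun i => (1 / 2 : ℝ) • g i - (1 / 2 : ℝ) • f)
    (r := 1 / 2 * (a + ‖toStrongDual f‖)) (fun i => by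
      rw [← smul_sub, map_smul, norm_smul, Real.norm_of_nonneg (by norm_num), map_sub]
      have := norm_sub_le (toStrongDual (g i)) (toStrongDual f)
      have := hga i
      linarith)
  have hδs : δ / 2 ≤ s := ge_of_tendsto' hs fun i => by
    rw [← smul_sub, map_smul, norm_smul, Real.norm_of_nonneg (by norm_num)]
    linarith [hδ i]
  obtain ⟨b', hb', hm⟩ := gains_derHull l hε h0 h1 (fun i => ((1 / 2 : ℝ) • g i, b i))
    ((1 / 2 : ℝ) • f) d s hb (hgf.const_smul _) hd hs
  refine ⟨b', hm, ?_⟩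
  have h3 : gain ε (δ / 2) ≤ gain ε s := max_le_max le_rfl (by gcongr)
  have h4 : c + 2 * (1 - d / n) ≤ a :=
    le_of_tendsto' (hc.add ((tendsto_const_nhds.sub (hd.div_const _)).const_mul 2)) hba
  have h5 : (d + gain ε (δ / 2)) / n ≤ b' / n := by gcongr; linarith
  have h6 : (d + gain ε (δ / 2)) / n = d / n + gain ε (δ / 2) / n := by ring
  have h7 : 2 * gain ε (δ / 2) / n = 2 * (gain ε (δ / 2) / n) := by ring
  rw [h7]; linarith

/-- This is the limit lemma with no separation, `δ = 0`. -/
theorem isClosed_sublevel (hε : 0 < ε) (hn : 1 ≤ n) (h0 : (der X ε n).Nonempty)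
    (h1 : der X ε (n + 1) = ∅) (a : ℝ) : IsClosed (sublevel X ε n a) := by
  rw [isClosed_iff_ultrafilter]
  intro f l hl hm
  let l' : Ultrafilter (sublevel X ε n a) := l.comap Subtype.val_injective (by simpa using hm)
  have ht : Tendsto (fun g : sublevel X ε n a => (g : WeakDual ℝ X)) l' (𝓝 f) := by
    rw [Ultrafilter.coe_comap]
    exact tendsto_comap.mono_right hl
  have := sublevel_limit l' hε hn h0 h1 (δ := 0) (fun g => g.2) ht (fun _ => norm_nonneg _)
  refine sublevel_mono ?_ this
  have : 0 ≤ 2 * gain ε (0 / 2) / n := by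
    have : 0 ≤ gain ε (0 / 2) := le_max_left _ _
    positivity
  linarith

end Sublevel

/-! ### The norm with a weak* Kadec–Klee property. -/

section PolarNorm

variable {X : Type u} [NormedAddCommGroup X] [NormedSpace ℝ X]

/-- A weak*-closed convex symmetric set of functionals between two balls is the dual ball of
an equivalent norm. -/
theorem exists_seminorm_of_dual_set {D : Set (WeakDual ℝ X)} (hc : Convex ℝ D) (hcl : IsClosed D)
    (hneg : ∀ f ∈ D, -f ∈ D) (hle : ∀ f ∈ D, ‖toStrongDual f‖ ≤ 1)
    (hge : ∀ f : WeakDual ℝ X, ‖toStrongDual f‖ ≤ 1 / 2 → f ∈ D) :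
    ∃ p : Seminorm ℝ X, (∀ x, ‖x‖ / 2 ≤ p x ∧ p x ≤ ‖x‖) ∧
      ∀ f : WeakDual ℝ X, f ∈ D ↔ ∀ x, |f x| ≤ p x := by
  have h0 : (0 : WeakDual ℝ X) ∈ D := hge 0 (by simp)
  have : Nonempty D := ⟨⟨0, h0⟩⟩
  have hfx : ∀ f ∈ D, ∀ x : X, |f x| ≤ ‖x‖ := fun f hf x => by
    have h1 := (toStrongDual f).le_opNorm x
    exact h1.trans (mul_le_of_le_one_left (norm_nonneg x) (hle f hf))
  have hbdd : ∀ x : X, BddAbove (Set.range fun f : D => |(f : WeakDual ℝ X) x|) := fun x =>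
    ⟨‖x‖, by rintro _ ⟨f, rfl⟩; exact hfx f f.2 x⟩
  let p : Seminorm ℝ X := Seminorm.of (fun x => ⨆ f : D, |(f : WeakDual ℝ X) x|)
    (fun x y => ciSup_le fun f => by
      rw [map_add]
      exact (abs_add_le _ _).trans (add_le_add (le_ciSup (hbdd x) f) (le_ciSup (hbdd y) f)))
    (fun c x => by
      simp only [map_smul, smul_eq_mul, abs_mul]
      rw [Real.norm_eq_abs, Real.mul_iSup_of_nonneg (abs_nonneg c)])
  have hp : ∀ x, p x = ⨆ f : D, |(f : WeakDual ℝ X) x| := fun _ => rfl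
  have hDp : ∀ f ∈ D, ∀ x, |f x| ≤ p x := fun f hf x => le_ciSup (hbdd x) ⟨f, hf⟩
  refine ⟨p, fun x => ⟨?_, ciSup_le fun f => hfx f f.2 x⟩, fun f => ⟨hDp f, fun hf => ?_⟩⟩
  · obtain ⟨g, hg, hgx⟩ := exists_dual_vector'' ℝ x
    have h1 : (1 / 2 : ℝ) • toWeakDual g ∈ D := hge _ (by
      rw [map_smul, norm_smul, Real.norm_of_nonneg (by norm_num)]
      simpa using hg)
    have h2 := hDp _ h1 x
    have h3 : ((1 / 2 : ℝ) • toWeakDual g) x = 1 / 2 * ‖x‖ := by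
      have : ((1 / 2 : ℝ) • toWeakDual g) x = 1 / 2 * g x := rfl
      rw [this, hgx]; rfl
    rw [h3, abs_of_nonneg (by positivity)] at h2
    linarith
  · by_contra hfD
    have : LocallyConvexSpace ℝ (WeakDual ℝ X) :=
      (WeakDual.withSeminorms (𝕜 := ℝ) (E := X)).toLocallyConvexSpace
    obtain ⟨φ, u, hu, huf⟩ := geometric_hahn_banach_closed_point hc hcl hfD
    -- The separating functional is weak* continuous, hence evaluation at a point of `X`.
    obtain ⟨x, hx⟩ := LinearMap.dualEmbedding_surjective (topDualPairing ℝ X) φ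
    have hφ : ∀ g : WeakDual ℝ X, φ g = g x := fun g => by rw [← hx]; rfl
    have h1 : p x ≤ u := ciSup_le fun g => abs_le.2 ⟨by
      have := hu _ (hneg g g.2)
      rw [hφ] at this
      have e : (-(g : WeakDual ℝ X)) x = -((g : WeakDual ℝ X) x) := rfl
      rw [e] at this
      linarith, by
      have := hu _ g.2
      rw [hφ] at this
      exact this.le⟩
    have h2 := hf x
    rw [hφ] at huf
    linarith [le_abs_self (f x)]

/-- The norm with a quantitative weak* Kadec–Klee type property given by finiteness of the convex
index. -/
theorem exists_kadec_norm {ε : ℝ} (hε : 0 < ε) {n : ℕ} (hn : 1 ≤ n) (h0 : (der X ε n).Nonempty)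
    (h1 : der X ε (n + 1) = ∅) :
    ∃ p : Seminorm ℝ X, (∀ x, ‖x‖ / 2 ≤ p x ∧ p x ≤ ‖x‖) ∧
      ∀ (f : WeakDual ℝ X) (fs : ℕ → WeakDual ℝ X) (r : ℝ), Tendsto fs atTop (𝓝 0) →
        1 ≤ r → r < 1 + 1 / n → (∀ x, |f x| ≤ p x) →
        (∃ᶠ i in atTop, (∀ x, |(f + fs i) x| ≤ r * p x) ∧ 10 * ε ≤ ‖toStrongDual (fs i)‖) →
        ∃ q, 0 ≤ q ∧ q < 1 ∧ ∀ x, |f x| ≤ q * p x := by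
  have hn0 : (0 : ℝ) < n := by exact_mod_cast hn
  obtain ⟨p, hp, hD⟩ := exists_seminorm_of_dual_set (D := sublevel X ε n 1)
    (fun f hf g hg s t hs ht hst => by
      have := sublevel_combo hf hg hs ht hst
      rwa [mul_one, mul_one, hst] at this)
    (isClosed_sublevel hε hn h0 h1 1) (fun f hf => neg_mem_sublevel hf)
    (fun f hf => norm_le_of_mem_sublevel hn hf)
    (fun f hf => by
      have := mem_sublevel_of_norm_le hn h0 (r := 1 / 4) (by norm_num) (by norm_num)
        (hf.trans (by norm_num))
      norm_num at this
      exact this)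
  refine ⟨p, hp, ?_⟩
  intro f fs r hfs hr1 hrn hf hfreq
  have hr0 : 0 < r := by linarith
  obtain ⟨φ, hφ, hφ'⟩ := extraction_of_frequently_atTop hfreq
  have hsm : ∀ (c : ℝ) (g : WeakDual ℝ X) (x : X), (c • g) x = c * g x := fun _ _ _ => rfl
  have hg : ∀ i, r⁻¹ • (f + fs (φ i)) ∈ sublevel X ε n 1 := fun i => (hD _).2 fun x => by
    rw [hsm, abs_mul, abs_of_pos (inv_pos.2 hr0), inv_mul_le_iff₀ hr0]
    exact (hφ' i).1 x
  have hlim : Tendsto (fun i => r⁻¹ • (f + fs (φ i))) (Ultrafilter.of (atTop : Filter ℕ))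
      (𝓝 (r⁻¹ • f)) := by
    have := ((hfs.comp hφ.tendsto_atTop).const_add f).const_smul r⁻¹
    rw [add_zero] at this
    exact this.mono_left (Ultrafilter.of_le _)
  have hr2 : r ≤ 2 := by
    have : 1 / (n : ℝ) ≤ 1 := by
      rw [div_le_one hn0]; exact_mod_cast hn
    linarith
  -- Since `r ≤ 2`, separation `10 * ε` leaves `5 * ε`. The gain is then at least `5/2 - 1 = 3/2`,
  -- so the function is at most `1 - 3/n` at `r⁻¹ • f`.
  have key := sublevel_limit (Ultrafilter.of (atTop : Filter ℕ)) hε hn h0 h1 (δ := 5 * ε) hg hlim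
    (fun i => by
      rw [← smul_sub, add_sub_cancel_left, map_smul, norm_smul,
        Real.norm_of_nonneg (by positivity), ← div_eq_inv_mul, le_div_iff₀ hr0]
      have := (hφ' i).2
      nlinarith)
  have hgain : (3 : ℝ) / 2 ≤ gain ε (5 * ε / 2) := by
    refine le_trans (le_of_eq ?_) (le_max_right _ _)
    field_simp; norm_num
  have h2f : (2 : ℝ) • f ∈ sublevel X ε n 4 := by
    have := mem_sublevel_of_norm_le hn h0 (f := (2 : ℝ) • f) (r := 1) one_pos le_rfl (by
      rw [map_smul, norm_smul, Real.norm_of_nonneg (by norm_num)]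
      gcongr
      exact norm_le_of_mem_sublevel hn ((hD f).2 hf))
    rwa [mul_one] at this
  -- The slack `3/n` pays for mixing in `2 • f`, where the function is at most 4. The mixture is `κ
  -- • f`, still in the dual ball, and `r < 1 + 1/n` gives `κ > 1`.
  have hcomb := sublevel_combo key h2f (s := (n + 1) / (n + 2)) (t := 1 / (n + 2))
    (by positivity) (by positivity) (by field_simp; ring)
  have hle : (n + 1 : ℝ) / (n + 2) * (1 - 2 * gain ε (5 * ε / 2) / n) + 1 / (n + 2) * 4 ≤ 1 := by
    have h3 : 3 / (n : ℝ) ≤ 2 * gain ε (5 * ε / 2) / n := by gcongr; linarith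
    have h4 : (n + 1 : ℝ) / (n + 2) * (1 - 2 * gain ε (5 * ε / 2) / n) ≤
        (n + 1 : ℝ) / (n + 2) * (1 - 3 / n) := by gcongr
    have h5 : (n + 1 : ℝ) / (n + 2) * (1 - 3 / n) + 1 / (n + 2) * 4 ≤ 1 := by
      have e : 1 - ((n + 1 : ℝ) / (n + 2) * (1 - 3 / n) + 1 / (n + 2) * 4) = 3 / (n * (n + 2)) := by
        field_simp; ring
      have : (0 : ℝ) ≤ 3 / (n * (n + 2)) := by positivity
      linarith
    linarith
  have hmem := (hD _).1 (sublevel_mono hle hcomb)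
  set κ : ℝ := (n + 1) / (n + 2) * r⁻¹ + 1 / (n + 2) * 2 with hκ
  have hκ1 : 1 < κ := by
    have h6 : (n : ℝ) / (n + 1) < r⁻¹ := by
      rw [lt_inv_comm₀ (by positivity) hr0, inv_div]
      refine hrn.trans_le (le_of_eq ?_)
      field_simp
    have h7 : (n + 1 : ℝ) / (n + 2) * (n / (n + 1)) < (n + 1) / (n + 2) * r⁻¹ := by gcongr
    have e : (n + 1 : ℝ) / (n + 2) * (n / (n + 1)) + 1 / (n + 2) * 2 = 1 := by field_simp
    linarith
  refine ⟨κ⁻¹, by positivity, inv_lt_one_of_one_lt₀ hκ1, fun x => ?_⟩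
  have h8 := hmem x
  rw [smul_smul, smul_smul, ← add_smul, hsm, abs_mul, abs_of_pos (by linarith)] at h8
  rw [← div_eq_inv_mul, le_div_iff₀ (by linarith), mul_comm]
  exact h8

end PolarNorm

end Szlenk

namespace Szlenk

open WeakDual StrongDual

/-! ### The value at 0 and the first derivative. -/

section Degenerate

variable {X : Type u} [NormedAddCommGroup X] [NormedSpace ℝ X] {ε : ℝ}

theorem nontrivial_of_infinite (h : ¬ FiniteDimensional ℝ X) : Nontrivial X := by
  by_contra hn
  rw [not_nontrivial_iff_subsingleton] at hn
  exact h inferInstance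

/-- Every point of the ball is approached by other points along a segment, so at `ε = 0` nothing is
removed and the index is infinite. -/
theorem dualBall_subset_iota_zero [Nontrivial X] : dualBall X ⊆ iota 0 (dualBall X) := by
  intro f hf
  obtain ⟨g, hg, hgf⟩ : ∃ g ∈ dualBall X, g ≠ f := by
    obtain ⟨v, hv, -⟩ := exists_dual_vector' ℝ (0 : X)
    have hv0 : toWeakDual v ≠ 0 := fun h => by
      have h' : v = 0 := by simpa using congrArg toStrongDual h
      rw [h', norm_zero] at hv
      exact zero_ne_one hv
    by_cases h : toWeakDual v = f
    · exact ⟨0, zero_mem_dualBall, fun h' => hv0 (h.trans h'.symm)⟩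
    · exact ⟨toWeakDual v, le_of_eq (by simpa using hv), h⟩
  refine mem_iota_of_frequently le_rfl (l := 𝓝[>] (0 : ℝ)) (g := fun s => f + s • (g - f)) hf ?_ ?_
  · have h1 : Tendsto (fun s : ℝ => f + s • (g - f)) (𝓝 0) (𝓝 (f + (0 : ℝ) • (g - f))) :=
      tendsto_const_nhds.add (tendsto_id.smul_const _)
    rw [zero_smul, add_zero] at h1
    exact h1.mono_left nhdsWithin_le_nhds
  · refine Eventually.frequently ?_
    filter_upwards [Ioc_mem_nhdsGT (zero_lt_one' ℝ)] with s hs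
    refine ⟨?_, ?_⟩
    · have := convex_dualBall hf hg (sub_nonneg.2 hs.2) hs.1.le (by ring)
      convert this using 1
      module
    · rw [add_sub_cancel_left, norm_pos_iff]
      intro h
      have h' : s • (g - f) = 0 := by simpa using congrArg toWeakDual h
      rcases smul_eq_zero.1 h' with h2 | h2
      · exact hs.1.ne' h2
      · exact hgf (sub_eq_zero.1 h2)

theorem H_zero [Nontrivial X] : H X 0 = 0 := by
  have h : ∀ n, dualBall X ⊆ der X 0 n := by
    intro n
    induction n with
    | zero => exact Set.Subset.rfl
    | succ n ih =>
      have e : der X 0 n = dualBall X := (der_subset_dualBall n).antisymm ih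
      rw [der_succ, e]
      exact dualBall_subset_iota_zero.trans (iota_subset_iotaHat _ _)
  rcases Cz_eq_top_or (X := X) (ε := 0) with h1 | ⟨n, -, -, h2⟩
  · exact H_eq_zero h1
  · exact absurd h2 (Set.Nonempty.ne_empty ⟨0, h _ zero_mem_dualBall⟩)

/-- A basic neighbourhood restricts only finitely many evaluations, and their common kernel is
nonzero; otherwise the dual, hence the bidual and `X`, would be finite-dimensional. -/
theorem exists_norm_one_mem_nhds (h : ¬ FiniteDimensional ℝ X) {V : Set (WeakDual ℝ X)}
    (hV : V ∈ 𝓝 0) : ∃ g ∈ V, ‖toStrongDual g‖ = 1 := by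
  obtain ⟨⟨s, r⟩, hr, hs⟩ := (WeakDual.withSeminorms (𝕜 := ℝ) (E := X)).hasBasis_zero_ball.mem_iff.1 hV
  let L : StrongDual ℝ X →ₗ[ℝ] (s → ℝ) := LinearMap.pi fun x =>
    (LinearMap.applyₗ (x : X)).comp (ContinuousLinearMap.coeLM ℝ)
  have hL : ∃ g : StrongDual ℝ X, g ≠ 0 ∧ L g = 0 := by
    by_contra! hinj
    have hker : LinearMap.ker L = ⊥ := LinearMap.ker_eq_bot'.2 fun g hg => by
      by_contra hg0
      exact hinj g hg0 hg
    have h1 : FiniteDimensional ℝ (StrongDual ℝ X) :=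
      FiniteDimensional.of_injective L (LinearMap.ker_eq_bot.1 hker)
    have h2 : FiniteDimensional ℝ (StrongDual ℝ (StrongDual ℝ X)) := inferInstance
    exact h (FiniteDimensional.of_injective
      (NormedSpace.inclusionInDoubleDual ℝ X).toLinearMap
      (NormedSpace.inclusionInDoubleDualLi ℝ).injective)
  obtain ⟨g, hg0, hLg⟩ := hL
  have hn := norm_ne_zero_iff.2 hg0
  refine ⟨toWeakDual (‖g‖⁻¹ • g), hs ?_, ?_⟩
  · rw [Seminorm.mem_ball, sub_zero]
    refine Seminorm.finset_sup_apply_lt hr fun x hx => ?_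
    have h1 : g x = 0 := congrFun hLg ⟨x, hx⟩
    have h2 : (toWeakDual (‖g‖⁻¹ • g)) x = ‖g‖⁻¹ * g x := rfl
    rw [WeakDual.seminormFamily_apply, h2, h1]
    simpa using hr
  · rw [toStrongDual_toWeakDual, norm_smul, norm_inv, norm_norm, inv_mul_cancel₀ hn]

theorem der_one_nonempty (h : ¬ FiniteDimensional ℝ X) (h0 : 0 ≤ ε) (h1 : ε < 1) :
    (der X ε 1).Nonempty := by
  refine ⟨0, ?_⟩
  rw [der_succ]
  refine iota_subset_iotaHat _ _ (mem_iota_of_frequently h0 (l := 𝓝 0) (g := id)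
    zero_mem_dualBall tendsto_id (frequently_iff.2 fun hV => ?_))
  obtain ⟨g, hg, hg1⟩ := exists_norm_one_mem_nhds h hV
  exact ⟨g, hg, le_of_eq hg1, by simpa [hg1] using h1⟩

end Degenerate

/-! ### Lower estimates: `H` is dominated by `psi`, and part (1). -/

section Lower

variable {X : Type u} [NormedAddCommGroup X] [NormedSpace ℝ X]

theorem one_add_inv_eq {n : ℕ} (hn : 1 ≤ n) :
    1 + ((n : ℝ≥0∞))⁻¹ = ENNReal.ofReal (1 + 1 / n) := by
  have hn0 : (0 : ℝ) < n := by exact_mod_cast hn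
  rw [ENNReal.ofReal_add zero_le_one (by positivity), one_div, ENNReal.ofReal_inv_of_pos hn0]
  simp

/-- If `liminf u < ofReal R` with `1 < R`, then frequently `u ≤ ofReal r` for some
`r ∈ [1, R)`. -/
theorem exists_frequently_le {u : ℕ → ℝ≥0∞} {R : ℝ} (hR : 1 < R)
    (h : liminf u atTop < ENNReal.ofReal R) :
    ∃ r, 1 ≤ r ∧ r < R ∧ ∃ᶠ i in atTop, u i ≤ ENNReal.ofReal r := by
  obtain ⟨c, hc, hcR⟩ := exists_between h
  have hc' : c ≠ ⊤ := (hcR.trans ENNReal.ofReal_lt_top).ne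
  refine ⟨max 1 c.toReal, le_max_left _ _,
    max_lt hR ((ENNReal.lt_ofReal_iff_toReal_lt hc').1 hcR), ?_⟩
  refine (frequently_lt_of_liminf_lt (by isBoundedDefault) hc).mono fun i hi => ?_
  exact hi.le.trans (ENNReal.le_ofReal_iff_toReal_le hc' (by positivity) |>.2 (le_max_right _ _))

/-- Were the estimate false for a unit `f`, the Kadec–Klee property would give `‖f‖ ≤ q < 1`. The
norms differ by a factor 2, so eventual separation above `t / 2` in the dual of `Y` gives more than
`t / 4 ≥ 10 * ε`. -/
theorem inv_le_theta_of_transport {Y : Type u} [NormedAddCommGroup Y] [NormedSpace ℝ Y]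
    {p : Seminorm ℝ X} (hp : ∀ x, ‖x‖ / 2 ≤ p x ∧ p x ≤ ‖x‖) (T : X ≃L[ℝ] Y)
    (hT : ∀ x, ‖T x‖ = p x) {n : ℕ} (hn : 1 ≤ n) {ε t : ℝ} (ht : 0 < t) (hεt : 100 * ε ≤ t)
    (hK : ∀ (f : WeakDual ℝ X) (fs : ℕ → WeakDual ℝ X) (r : ℝ), Tendsto fs atTop (𝓝 0) →
        1 ≤ r → r < 1 + 1 / n → (∀ x, |f x| ≤ p x) →
        (∃ᶠ i in atTop, (∀ x, |(f + fs i) x| ≤ r * p x) ∧ 10 * ε ≤ ‖toStrongDual (fs i)‖) →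
        ∃ q, 0 ≤ q ∧ q < 1 ∧ ∀ x, |f x| ≤ q * p x) :
    ((n : ℝ≥0∞))⁻¹ ≤ theta Y t := by
  have hn0 : (0 : ℝ) < n := by exact_mod_cast hn
  refine le_sSup ?_
  intro f fs hf hfs hl
  rw [one_add_inv_eq hn]
  by_contra! hlt
  obtain ⟨r, hr1, hrn, hfr⟩ := exists_frequently_le (by
    have : (0 : ℝ) < 1 / n := by positivity
    linarith) hlt
  let pull : StrongDual ℝ Y → WeakDual ℝ X := fun g => toWeakDual (g.comp (T : X →L[ℝ] Y))
  have hpull : ∀ g x, pull g x = g (T x) := fun _ _ => rfl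
  have hbound : ∀ (g : StrongDual ℝ Y) (c : ℝ), ‖g‖ ≤ c → ∀ x, |pull g x| ≤ c * p x := by
    intro g c hg x
    rw [hpull, ← hT]
    exact g.le_of_opNorm_le hg _
  have hev : ∀ᶠ i in atTop, t / 2 < ‖fs i‖ := by
    have h1 : ENNReal.ofReal (t / 2) < liminf (fun n => ‖fs n‖ₑ) atTop :=
      ((ENNReal.ofReal_lt_ofReal_iff ht).2 (by linarith)).trans_le hl
    filter_upwards [eventually_lt_of_lt_liminf h1] with i hi
    rw [← ofReal_norm] at hi
    exact (ENNReal.ofReal_lt_ofReal_iff_of_nonneg (by positivity)).1 hi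
  obtain ⟨q, hq0, hq1, hq⟩ := hK (pull f) (fun i => pull (fs i)) r
    (tendsto_weakDual_iff.2 fun x => by
      have := tendsto_weakDual_iff.1 hfs (T x)
      exact this)
    hr1 hrn (by simpa using hbound f 1 hf.le) ((hfr.and_eventually hev).mono fun i hi => by
      have h1 : ‖f + fs i‖ ≤ r := by
        have := hi.1
        rwa [← ofReal_norm, ENNReal.ofReal_le_ofReal_iff (by linarith)] at this
      refine ⟨fun x => hbound (f + fs i) r h1 x, ?_⟩
      have h2 : ‖fs i‖ ≤ 2 * ‖toStrongDual (pull (fs i))‖ := by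
        refine ContinuousLinearMap.opNorm_le_bound _ (by positivity) fun y => ?_
        have h3 := (toStrongDual (pull (fs i))).le_opNorm (T.symm y)
        have h4 : toStrongDual (pull (fs i)) (T.symm y) = fs i y := by
          rw [toStrongDual_apply, hpull, T.apply_symm_apply]
        have h5 : ‖T.symm y‖ ≤ 2 * ‖y‖ := by
          have := (hp (T.symm y)).1
          rw [← hT, T.apply_symm_apply] at this
          linarith
        rw [h4] at h3
        refine h3.trans ?_
        rw [mul_comm (2 : ℝ), mul_assoc]
        gcongr
      linarith [hi.2])
  have : ‖f‖ ≤ q := ContinuousLinearMap.opNorm_le_bound _ hq0 fun y => by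
    have := hq (T.symm y)
    rwa [hpull, ← hT, T.apply_symm_apply] at this
  linarith

theorem dominates_psi_H [CompleteSpace X] (hX : ¬ FiniteDimensional ℝ X) :
    Dominates 100 (psi X) (H X) := by
  intro t ht ht1
  have := nontrivial_of_infinite hX
  rcases ht.eq_or_lt with rfl | ht
  · simp [H_zero]
  rcases Cz_eq_top_or (X := X) (ε := t / 100) with h | ⟨n, h1, h2, h3⟩
  · simp [H_eq_zero h]
  rw [H_eq_inv h1]
  -- For `n = 0` the value of `H` would be infinite; infinite dimension excludes this through the
  -- first derivative.
  have hn : 1 ≤ n := by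
    by_contra! hn
    obtain rfl : n = 0 := by omega
    exact (der_one_nonempty hX (by positivity) (by linarith)).ne_empty h3
  obtain ⟨p, hp, hK⟩ := exists_kadec_norm (by positivity) hn h2 h3
  obtain ⟨Y, _, _, _, T, hT, hd⟩ := exists_renorming p (a := 1 / 2) (b := 1) (by norm_num)
    (by norm_num) (fun x => ⟨by linarith [(hp x).1], by linarith [(hp x).2]⟩)
  have h4 : theta Y t ≤ psi X t := le_sSup ⟨Y, inferInstance, inferInstance, inferInstance, hd, rfl⟩
  exact (inv_le_theta_of_transport hp T hT hn ht (by linarith) hK).trans h4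

theorem dualNorm_le_iff {p : Seminorm ℝ X} (hp : ∀ x, ‖x‖ / 2 ≤ p x) {f : StrongDual ℝ X} {r : ℝ}
    (hr : 0 ≤ r) : dualNorm p f ≤ ENNReal.ofReal r ↔ ∀ x, |f x| ≤ r * p x := by
  constructor
  · intro h x
    rcases (apply_nonneg p x).eq_or_lt with hx | hx
    · have h1 := hp x
      rw [← hx] at h1
      have h2 : x = 0 := norm_le_zero_iff.1 (by linarith)
      simp [h2]
    · have h1 : p ((p x)⁻¹ • x) ≤ 1 := by
        rw [map_smul_eq_mul, Real.norm_of_nonneg (by positivity), inv_mul_cancel₀ hx.ne']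
      have h2 := (le_iSup₂ (f := fun (x : X) (_ : p x ≤ 1) => ‖f x‖ₑ) _ h1).trans h
      rw [← ofReal_norm, ENNReal.ofReal_le_ofReal_iff hr, map_smul, norm_smul,
        Real.norm_of_nonneg (by positivity), inv_mul_le_iff₀ hx, mul_comm] at h2
      exact h2
  · intro h
    refine iSup₂_le fun x hx => ?_
    rw [← ofReal_norm]
    refine ENNReal.ofReal_le_ofReal ((h x).trans ?_)
    nlinarith

/-- Weak* lower semicontinuity of the dual norm, tested at a single nearly norming vector. -/
theorem one_le_liminf_dualNorm {p : Seminorm ℝ X} {f : StrongDual ℝ X}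
    {fs : ℕ → StrongDual ℝ X} (hf : dualNorm p f = 1)
    (hfs : Tendsto (fun n => StrongDual.toWeakDual (fs n)) atTop (𝓝 0)) :
    1 ≤ liminf (fun n => dualNorm p (f + fs n)) atTop := by
  refine le_of_forall_lt fun c hc => ?_
  obtain ⟨d, hcd, hd⟩ := exists_between hc
  rw [← hf, dualNorm, lt_iSup_iff] at hd
  obtain ⟨x, hd⟩ := hd
  obtain ⟨hx, hd⟩ := lt_iSup_iff.1 hd
  have h1 : Tendsto (fun n => ‖(f + fs n) x‖ₑ) atTop (𝓝 ‖f x‖ₑ) := by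
    have h2 := ((tendsto_weakDual_iff.1 hfs x).const_add (f x)).enorm
    have e : f x + (0 : WeakDual ℝ X) x = f x := add_zero _
    rw [e] at h2
    exact h2
  refine hcd.trans_le (le_liminf_of_le (by isBoundedDefault) ?_)
  filter_upwards [h1.eventually_const_lt hd] with n hn
  exact hn.le.trans (le_iSup₂ (f := fun (x : X) (_ : p x ≤ 1) => ‖(f + fs n) x‖ₑ) x hx)

theorem exists_norm_liminf (X : Type u) [NormedAddCommGroup X] [NormedSpace ℝ X] {τ : ℝ}
    (hτ : 0 < τ) (hτ1 : τ < 1) :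
    ∃ p : Seminorm ℝ X, (∀ x, ‖x‖ / 2 ≤ p x ∧ p x ≤ ‖x‖) ∧
      ∀ (f : StrongDual ℝ X) (fs : ℕ → StrongDual ℝ X),
        dualNorm p f = 1 → (∀ n, dualNorm p (fs n) = ENNReal.ofReal τ) →
        Tendsto (fun n => StrongDual.toWeakDual (fs n)) atTop (𝓝 0) →
        1 + ((Cz X (τ / 100) : ℝ≥0∞))⁻¹ ≤ liminf (fun n => dualNorm p (f + fs n)) atTop := by
  have hn1 : ∀ x : X, ‖x‖ / 2 ≤ normSeminorm ℝ X x ∧ normSeminorm ℝ X x ≤ ‖x‖ := fun x =>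
    ⟨half_le_self (norm_nonneg x), le_rfl⟩
  have hlow : ∀ (p : Seminorm ℝ X), (∀ x, ‖x‖ / 2 ≤ p x ∧ p x ≤ ‖x‖) → ∀ g : StrongDual ℝ X,
      dualNorm p g = ENNReal.ofReal τ → τ / 2 ≤ ‖g‖ ∧ ‖g‖ ≤ τ := by
    intro p hp g hg
    constructor
    · have h1 : dualNorm p g ≤ ENNReal.ofReal (2 * ‖g‖) :=
        (dualNorm_le_iff (fun x => (hp x).1) (by positivity)).2 fun x => by
          have h2 := g.le_opNorm x
          rw [Real.norm_eq_abs] at h2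
          have h3 := mul_le_mul_of_nonneg_left (hp x).1 (norm_nonneg g)
          linarith
      rw [hg, ENNReal.ofReal_le_ofReal_iff (by positivity)] at h1
      linarith
    · refine ContinuousLinearMap.opNorm_le_bound _ hτ.le fun x => ?_
      have h1 := (dualNorm_le_iff (fun x => (hp x).1) hτ.le).1 hg.le x
      rw [Real.norm_eq_abs]
      exact h1.trans (by gcongr; exact (hp x).2)
  rcases Cz_eq_top_or (X := X) (ε := τ / 100) with h | ⟨n, h1, h2, h3⟩
  · refine ⟨normSeminorm ℝ X, hn1, fun f fs hf _ hfs => ?_⟩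
    simpa [h] using one_le_liminf_dualNorm hf hfs
  -- For `n = 0` no admissible sequence exists: its weak* limit 0 would lie in the empty first
  -- derivative.
  rcases Nat.eq_zero_or_pos n with rfl | hn
  · refine ⟨normSeminorm ℝ X, hn1, fun f fs _ hτs hfs => ?_⟩
    exfalso
    have h4 : (0 : WeakDual ℝ X) ∈ der X (τ / 100) (0 + 1) :=
      mem_der_add (by positivity) (l := atTop) (g := fun i => toWeakDual (fs i))
        (fun i => (hlow _ hn1 _ (hτs i)).2.trans hτ1.le) hfs (Eventually.of_forall fun i => by
          have := (hlow _ hn1 _ (hτs i)).1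
          rw [sub_zero, toStrongDual_toWeakDual]
          push_cast
          linarith)
    rw [h3] at h4
    exact h4
  · obtain ⟨p, hp, hK⟩ := exists_kadec_norm (by positivity) hn h2 h3
    refine ⟨p, hp, fun f fs hf hτs hfs => ?_⟩
    have hn0 : (0 : ℝ) < n := by exact_mod_cast hn
    -- Here `Cz = n + 1`, so the bound `1 + 1/n` given by the norm is more than needed.
    have e : ((Cz X (τ / 100) : ℝ≥0∞))⁻¹ ≤ ((n : ℝ≥0∞))⁻¹ := by
      rw [h1, ENNReal.inv_le_inv]; simp
    refine (add_le_add_right e 1).trans ?_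
    rw [one_add_inv_eq hn]
    by_contra! hlt
    obtain ⟨r, hr1, hrn, hfr⟩ := exists_frequently_le (by
      have : (0 : ℝ) < 1 / n := by positivity
      linarith) hlt
    have hp' := fun x => (hp x).1
    obtain ⟨q, hq0, hq1, hq⟩ := hK (toWeakDual f) (fun i => toWeakDual (fs i)) r hfs hr1 hrn
      (fun x => by
        have := (dualNorm_le_iff hp' zero_le_one).1 (hf.le.trans (by simp)) x
        rwa [one_mul] at this)
      (hfr.mono fun i hi => ⟨(dualNorm_le_iff hp' (by linarith)).1 hi, by
        have := (hlow p hp _ (hτs i)).1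
        rw [toStrongDual_toWeakDual]
        linarith⟩)
    have h4 : dualNorm p f ≤ ENNReal.ofReal q := (dualNorm_le_iff hp' hq0).2 hq
    rw [hf, ENNReal.one_le_ofReal] at h4
    linarith

end Lower

end Szlenk

end

theorem theorem4p6 :
    ∃ C : ℝ, 1 ≤ C ∧ C ≤ 19200 ∧
      (∀ (X : Type u) [NormedAddCommGroup X] [NormedSpace ℝ X] [CompleteSpace X]
          [TopologicalSpace.SeparableSpace X],
        Szlenk.Sz X = Ordinal.omega0 →
        ∀ τ : ℝ, 0 < τ → τ < 1 →
          ∃ p : Seminorm ℝ X, (∀ x, ‖x‖ / 2 ≤ p x ∧ p x ≤ ‖x‖) ∧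
            ∀ (f : StrongDual ℝ X) (fs : ℕ → StrongDual ℝ X),
              Szlenk.dualNorm p f = 1 →
              (∀ n, Szlenk.dualNorm p (fs n) = ENNReal.ofReal τ) →
              Tendsto (fun n => StrongDual.toWeakDual (fs n)) atTop (𝓝 0) →
              1 + ((Szlenk.Cz X (τ / C) : ℝ≥0∞))⁻¹ ≤
                liminf (fun n => Szlenk.dualNorm p (f + fs n)) atTop) ∧
      (∀ (X : Type u) [NormedAddCommGroup X] [NormedSpace ℝ X] [CompleteSpace X]
          [TopologicalSpace.SeparableSpace X],
        ¬ FiniteDimensional ℝ X → ¬ Szlenk.ContainsEllOne X →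
          Szlenk.Equivalent C (fun σ => ((Szlenk.N X σ : ℝ≥0∞))⁻¹) (Szlenk.phi X) ∧
          Szlenk.Equivalent C (Szlenk.H X) (Szlenk.psi X)) := by
  refine ⟨100, by norm_num, by norm_num, ?_, ?_⟩
  · intro X _ _ _ _ _ τ hτ hτ1
    exact Szlenk.exists_norm_liminf X hτ hτ1
  · intro X _ _ _ _ hX _
    have := Szlenk.nontrivial_of_infinite hX
    exact ⟨⟨Szlenk.dominates_inv_N_phi, Szlenk.dominates_phi_inv_N⟩,
      ⟨Szlenk.dominates_H_psi, Szlenk.dominates_psi_H hX⟩⟩
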